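/- Let $X$ be a compact complex manifold, $(S,o)$ a pointed complex manifold (the base of the deformation; only its germ at $o$ matters, and $(S,o)=(\mathbb C,0)$ is the basic case), $\mathcal E\to X\times S$ a holomorphic vector bundle with a smooth hermitian metric $g$, and $\mathcal E_0=\mathcal E|_{X\times\{o\}}$. For $t\in S$ let $\mathcal E_t=\mathcal E|_{X\times\{t\}}$ and let $\Theta^t=\partial_X\bar\partial_X\log\det g|_{\mathcal E_t}$ be its Ricci curvature form, where $\det g$ is the Gram determinant of $g$ in a local holomorphic frame. Suppose that the deformation $(\mathcal E,g)$ is Ricci-flat, i.e. $\Theta^t=\Theta^o$ for all $t\in S$. Let $(U_i)$ be an open cover of $X$ with holomorphic isomorphisms $\psi_i:\mathcal E\to \mathrm{pr}_1^*\mathcal E_0$ defined near $U_i\times\{o\}$ which are the identity on $U_i\times\{o\}$ (such data always exist), and put $\theta_{ij}=\psi_i\circ\psi_j^{-1}$. For a tangent vector $v\in T_oS$ let $h_{ij}=\partial_v\theta_{ij}|_{t=o}\in \mathrm{End}(\mathcal E_0|_{U_i\cap U_j})$ and let $h\in H^1(X,\mathcal End(\mathcal E_0))$ be the class of the cocycle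 $(h_{ij})$. (If $S\subseteq\mathbb C$, $o=0$ and $v=\partial/\partial t$, then $\theta_{ij}=\mathrm{Id}+t\,h_{ij}+\cdots$.) Then $$\frac1{2\pi i}\,\mathrm{tr}\,h\in V,$$ where $\mathrm{tr}:H^1(X,\mathcal End(\mathcal E_0))\to H^1(X,\mathcal O_X)$ is induced by the trace, $i_*:H^1(X,\mathbb R)\to H^1(X,\mathcal O_X)$ is induced by the inclusion $\mathbb R\subset\mathcal O_X$, and $V$ is the maximal complex subspace of $i_*H^1(X,\mathbb R)$, i.e. the largest complex linear subspace of $H^1(X,\mathcal O_X)$ contained in $i_*H^1(X,\mathbb R)$. -/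

import Mathlib

open Bundle TopologicalSpace
open scoped Manifold ContDiff Topology ComplexConjugate

noncomputable section

namespace RicciFlat

/-! ### Čech cohomology of sheaves of sections -/

/-- A sheaf of `R`-modules on `X` whose sections over an open set `W` are those families
`f : ∀ y, V y` (regarded as given on `W` only) that satisfy a linear condition `f ∈ at' y`
at every point `y ∈ W`, where `f ∈ at' y` depends only on the germ of `f` at `y`. -/
structure SectionSheaf (R : Type*) [Ring R] (X : Type*) [TopologicalSpace X] (V : X → Type*)
    [∀ x, AddCommGroup (V x)] [∀ x, Module R (V x)] where
  at' : X → Submodule R (∀ y, V y)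
  congr' : ∀ (x : X) (f g : ∀ y, V y), (∀ᶠ y in 𝓝 x, f y = g y) → f ∈ at' x → g ∈ at' x

namespace SectionSheaf

variable {R : Type*} [Ring R] {X : Type*} [TopologicalSpace X] {V : X → Type*}
  [∀ x, AddCommGroup (V x)] [∀ x, Module R (V x)]

/-- Čech 1-cocycles for the sheaf `𝓕` and some open cover `(U x)` indexed by the points of `X`
(with `x ∈ U x`); these covers are cofinal among all open covers. The component `c x y` is a
section over `U x ∩ U y`; its values outside this set are irrelevant, since they are divided out
in `H1`. -/
def cocycles (𝓕 : SectionSheaf R X V) : Submodule R (X → X → ∀ z, V z) where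
  carrier := {c | ∃ U : ∀ x : X, OpenNhdsOf x,
    (∀ x y z, z ∈ U x → z ∈ U y → c x y ∈ 𝓕.at' z) ∧
    (∀ x y w z, z ∈ U x → z ∈ U y → z ∈ U w → c x y z + c y w z = c x w z)}
  zero_mem' := ⟨fun _ => ⊤, fun _ _ z _ _ => (𝓕.at' z).zero_mem, by simp⟩
  add_mem' := by
    rintro c d ⟨U, hU, hU'⟩ ⟨W, hW, hW'⟩
    refine ⟨fun x => U x ⊓ W x, fun x y z hx hy => ?_, fun x y w z hx hy hw => ?_⟩
    · exact (𝓕.at' z).add_mem (hU x y z hx.1 hy.1) (hW x y z hx.2 hy.2)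
    · have h1 := hU' x y w z hx.1 hy.1 hw.1
      have h2 := hW' x y w z hx.2 hy.2 hw.2
      simp only [Pi.add_apply]
      rw [← h1, ← h2]; abel
  smul_mem' := by
    rintro a c ⟨U, hU, hU'⟩
    refine ⟨U, fun x y z hx hy => (𝓕.at' z).smul_mem a (hU x y z hx hy), fun x y w z hx hy hw => ?_⟩
    simp only [Pi.smul_apply]
    rw [← hU' x y w z hx hy hw, smul_add]

/-- Čech 1-coboundaries: on the overlaps of some open cover `(U x)`, `c x y = b y - b x` for
sections `b x` over `U x`. -/
def coboundaries (𝓕 : SectionSheaf R X V) : Submodule R (X → X → ∀ z, V z) where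
  carrier := {c | ∃ (U : ∀ x : X, OpenNhdsOf x) (b : X → ∀ z, V z),
    (∀ x z, z ∈ U x → b x ∈ 𝓕.at' z) ∧
    (∀ x y z, z ∈ U x → z ∈ U y → c x y z = b y z - b x z)}
  zero_mem' := ⟨fun _ => ⊤, 0, fun _ z _ => (𝓕.at' z).zero_mem, by simp⟩
  add_mem' := by
    rintro c d ⟨U, b, hU, hU'⟩ ⟨W, b', hW, hW'⟩
    refine ⟨fun x => U x ⊓ W x, b + b', fun x z hx => ?_, fun x y z hx hy => ?_⟩
    · exact (𝓕.at' z).add_mem (hU x z hx.1) (hW x z hx.2)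
    · simp only [Pi.add_apply]
      rw [hU' x y z hx.1 hy.1, hW' x y z hx.2 hy.2]; abel
  smul_mem' := by
    rintro a c ⟨U, b, hU, hU'⟩
    refine ⟨U, a • b, fun x z hx => (𝓕.at' z).smul_mem a (hU x z hx), fun x y z hx hy => ?_⟩
    simp only [Pi.smul_apply]
    rw [hU' x y z hx hy, smul_sub]

theorem coboundaries_le_cocycles (𝓕 : SectionSheaf R X V) : 𝓕.coboundaries ≤ 𝓕.cocycles := by
  rintro c ⟨U, b, hb, hc⟩
  refine ⟨U, fun x y z hx hy => ?_, fun x y w z hx hy hw => ?_⟩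
  · refine 𝓕.congr' z (b y - b x) _ ?_ ((𝓕.at' z).sub_mem (hb y z hy) (hb x z hx))
    filter_upwards [(U x).isOpen.mem_nhds hx, (U y).isOpen.mem_nhds hy] with p hp hq
    exact (hc x y p hp hq).symm
  · rw [hc x y z hx hy, hc y w z hy hw, hc x w z hx hw]; abel

/-- The first Čech cohomology `H¹(X, 𝓕)`, i.e. the direct limit over all open covers of
1-cocycles modulo 1-coboundaries. -/
abbrev H1 (𝓕 : SectionSheaf R X V) : Type _ :=
  𝓕.cocycles ⧸ 𝓕.coboundaries.submoduleOf 𝓕.cocycles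

/-- The cohomology class of a cocycle. -/
def H1.mk (𝓕 : SectionSheaf R X V) (c : 𝓕.cocycles) : 𝓕.H1 :=
  Submodule.Quotient.mk c

variable {R' : Type*} [Ring R'] {V' : X → Type*}
  [∀ x, AddCommGroup (V' x)] [∀ x, Module R' (V' x)] {σ : R →+* R'}

/-- A family of (semi)linear maps applied to cochains. -/
def cochainMap (φ : ∀ x, V x →ₛₗ[σ] V' x) :
    (X → X → ∀ z, V z) →ₛₗ[σ] (X → X → ∀ z, V' z) where
  toFun c x y z := φ z (c x y z)
  map_add' c d := by ext; simp
  map_smul' a c := by ext; simp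

/-- The map in `H¹` induced by a morphism of sheaves, given by a family of (semi)linear maps that
carries sections of `𝓕` to sections of `𝓖`. -/
def H1.map {𝓕 : SectionSheaf R X V} {𝓖 : SectionSheaf R' X V'} (φ : ∀ x, V x →ₛₗ[σ] V' x)
    (hφ : ∀ x, ∀ f ∈ 𝓕.at' x, (fun y => φ y (f y)) ∈ 𝓖.at' x) : 𝓕.H1 →ₛₗ[σ] 𝓖.H1 :=
  Submodule.mapQ _ _
    (((cochainMap φ).domRestrict 𝓕.cocycles).codRestrict 𝓖.cocycles (by
      rintro ⟨c, U, hU, hU'⟩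
      refine ⟨U, fun x y z hx hy => hφ z _ (hU x y z hx hy), fun x y w z hx hy hw => ?_⟩
      change φ z (c x y z) + φ z (c y w z) = φ z (c x w z)
      rw [← map_add, hU' x y w z hx hy hw]))
    (by
      rintro ⟨c, hc⟩ ⟨U, b, hb, hcb⟩
      refine ⟨U, fun x z => φ z (b x z), fun x z hx => hφ z _ (hb x z hx), fun x y z hx hy => ?_⟩
      change φ z (c x y z) = _
      rw [← map_sub, ← hcb x y z hx hy]; rfl)

end SectionSheaf

/-! ### The sheaves `ℝ` and `𝒪_X`, and the subspace `V` -/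

/-- The constant sheaf `ℝ`: locally constant real functions. -/
def constSheaf (X : Type*) [TopologicalSpace X] : SectionSheaf ℝ X (fun _ => ℝ) where
  at' x :=
    { carrier := {f | ∀ᶠ y in 𝓝 x, f y = f x}
      zero_mem' := by simp
      add_mem' := by
        intro f g hf hg
        filter_upwards [hf, hg] with y h1 h2
        simp [h1, h2]
      smul_mem' := by
        intro a f hf
        filter_upwards [hf] with y h1
        simp [h1] }
  congr' x f g h hf := by
    have hx := h.self_of_nhds
    filter_upwards [h, hf] with y h1 h2
    rw [← h1, h2, hx]

section Structure

variable {E : Type*} [NormedAddCommGroup E] [NormedSpace ℂ E]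
  (X : Type*) [TopologicalSpace X] [ChartedSpace E X]

variable (E) in
/-- The sheaf `𝒪_X` of holomorphic functions. -/
def structureSheaf : SectionSheaf ℂ X (fun _ => ℂ) where
  at' x :=
    { carrier := {f | MDifferentiableAt 𝓘(ℂ, E) 𝓘(ℂ, ℂ) f x}
      zero_mem' := mdifferentiableAt_const
      add_mem' := fun hf hg => hf.add hg
      smul_mem' := fun a _ hf => hf.const_smul a }
  congr' _ _ _ h hf := hf.congr_of_eventuallyEq (h.mono fun _ hy => hy.symm)

variable (E) in
/-- The map `i_* : H¹(X, ℝ) → H¹(X, 𝒪_X)` induced by the inclusion `ℝ → 𝒪_X`. -/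
def iStar : (constSheaf X).H1 →ₛₗ[Complex.ofRealHom] (structureSheaf E X).H1 :=
  SectionSheaf.H1.map
    (fun _ =>
      { toFun := fun a : ℝ => (a : ℂ)
        map_add' := by simp
        map_smul' := by simp })
    (fun x f hf => by
      refine (mdifferentiableAt_const (c := ((f x : ℝ) : ℂ))).congr_of_eventuallyEq ?_
      exact Filter.Eventually.mono hf fun y hy => congrArg Complex.ofReal hy)

variable (E) in
/-- The maximal complex subspace `V` of `i_* H¹(X, ℝ) ⊆ H¹(X, 𝒪_X)`: the supremum of all complex
subspaces contained in it. -/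
def maxComplexSubspace : Submodule ℂ (structureSheaf E X).H1 :=
  sSup {L | (L : Set (structureSheaf E X).H1) ⊆ Set.range (iStar E X)}

/-- `V` is itself contained in `i_* H¹(X, ℝ)`, hence is the largest such complex subspace. -/
theorem maxComplexSubspace_isGreatest :
    IsGreatest {L : Submodule ℂ (structureSheaf E X).H1 |
      (L : Set (structureSheaf E X).H1) ⊆ Set.range (iStar E X)} (maxComplexSubspace E X) := by
  refine ⟨fun a ha => ?_, fun L hL => le_sSup hL⟩
  have ha' : a ∈ sSup {L : Submodule ℂ (structureSheaf E X).H1 |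
      (L : Set (structureSheaf E X).H1) ⊆ Set.range (iStar E X)} := ha
  rw [sSup_eq_iSup'] at ha'
  refine Submodule.iSup_induction _ (motive := fun a => a ∈ Set.range (iStar E X)) ha'
    (fun L x hx => L.2 hx) ⟨0, map_zero _⟩ ?_
  rintro _ _ ⟨p, rfl⟩ ⟨q, rfl⟩
  exact ⟨p + q, map_add _ _ _⟩

end Structure

/-! ### Families of vector bundles, their infinitesimal class, and curvature

Throughout, `𝓔` is a holomorphic vector bundle of rank `r` on `X × S`; it is regarded as a
deformation, with base `(S, o)`, of its restriction `𝓔₀` to `X × {o}`. -/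

section Deformation

variable {E : Type*} [NormedAddCommGroup E] [NormedSpace ℂ E]
  {T : Type*} [NormedAddCommGroup T] [NormedSpace ℂ T]
  {X : Type*} [TopologicalSpace X] [ChartedSpace E X]
  {S : Type*} [TopologicalSpace S] [ChartedSpace T S]

/-- The derivative at `o` in the direction `v` of a map from `S` to a normed space. -/
def dirDeriv {A : Type*} [NormedAddCommGroup A] [NormedSpace ℂ A] {o : S}
    (v : TangentSpace 𝓘(ℂ, T) o) (f : S → A) : A :=
  mfderiv 𝓘(ℂ, T) 𝓘(ℂ, A) f o v

theorem dirDeriv_conj_mul_inverse {𝔸 : Type*} [NormedRing 𝔸] [NormedAlgebra ℂ 𝔸] [CompleteSpace 𝔸]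
    {o : S} (v : TangentSpace 𝓘(ℂ, T) o) {M N : S → 𝔸} (hM : M o = 1) (hN : N o = 1)
    (dM : MDifferentiableAt 𝓘(ℂ, T) 𝓘(ℂ, 𝔸) M o) (dN : MDifferentiableAt 𝓘(ℂ, T) 𝓘(ℂ, 𝔸) N o)
    (A B : 𝔸) :
    dirDeriv v (fun t => A * (M t * Ring.inverse (N t)) * B) =
      A * (dirDeriv v M - dirDeriv v N) * B := by
  have hu : IsUnit (N o) := by rw [hN]; exact isUnit_one
  have dI : MDifferentiableAt 𝓘(ℂ, T) 𝓘(ℂ, 𝔸) (fun t => Ring.inverse (N t)) o :=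
    ((differentiableAt_inverse (𝕜 := ℂ) hu).mdifferentiableAt).comp o dN
  have hP := dM.hasMFDerivAt.mul' dI.hasMFDerivAt
  have hI := dI.hasMFDerivAt.mul' dN.hasMFDerivAt
  have hA := ((hasMFDerivAt_const (I := 𝓘(ℂ, T)) (I' := 𝓘(ℂ, 𝔸)) A o).mul' hP).mul'
    (hasMFDerivAt_const (I := 𝓘(ℂ, T)) (I' := 𝓘(ℂ, 𝔸)) B o)
  have hone : ((fun t => Ring.inverse (N t)) * N) =ᶠ[𝓝 o] fun _ => (1 : 𝔸) := by
    filter_upwards [dN.continuousAt.eventually (Units.isOpen.mem_nhds hu)] with t ht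
    exact Ring.inverse_mul_cancel _ ht
  have h1 := (hI.congr_of_eventuallyEq hone.symm).mfderiv.symm.trans
    (hasMFDerivAt_const (I := 𝓘(ℂ, T)) (I' := 𝓘(ℂ, 𝔸)) (1 : 𝔸) o).mfderiv
  have h2 : Ring.inverse (N o) * dirDeriv v N + dirDeriv v (fun t => Ring.inverse (N t)) * N o
      = 0 := congrArg (fun D : T →L[ℂ] 𝔸 => D v) h1
  have h3 : dirDeriv v (fun t => A * (M t * Ring.inverse (N t)) * B) =
      (A * (M o * Ring.inverse (N o))) * 0 +
      (A * (M o * dirDeriv v (fun t => Ring.inverse (N t)) +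
        dirDeriv v M * Ring.inverse (N o)) + 0 * (M o * Ring.inverse (N o))) * B :=
    congrArg (fun D : T →L[ℂ] 𝔸 => D v) hA.mfderiv
  rw [hN, Ring.inverse_one, one_mul, mul_one] at h2
  rw [h3, hM, hN, Ring.inverse_one, eq_neg_of_add_eq_zero_right h2]
  noncomm_ring

theorem mdifferentiableAt_dirDeriv {A : Type*} [NormedAddCommGroup A] [NormedSpace ℂ A]
    [IsManifold 𝓘(ℂ, E) ω X] [IsManifold 𝓘(ℂ, T) ω S] {o : S} (v : TangentSpace 𝓘(ℂ, T) o)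
    {f : X × S → A} {z₀ : X}
    (hf : ContMDiffAt (𝓘(ℂ, E).prod 𝓘(ℂ, T)) 𝓘(ℂ, A) ω f (z₀, o)) :
    MDifferentiableAt 𝓘(ℂ, E) 𝓘(ℂ, A) (fun z => dirDeriv v (fun t => f (z, t))) z₀ := by
  have h := ContMDiffAt.mfderiv_apply (I := 𝓘(ℂ, T)) (J := 𝓘(ℂ, E)) (J' := 𝓘(ℂ, E))
    (I' := 𝓘(ℂ, A)) (m := 1) (n := ω) (x₀ := z₀)
    (fun z t => f (z, t)) (fun _ => o) id (fun _ => v)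
    hf contMDiffAt_const contMDiffAt_id contMDiffAt_const (by simp)
  refine (h.mdifferentiableAt (by simp)).congr_of_eventuallyEq (.of_forall fun z => ?_)
  have e1 := inTangentCoordinates_eq (I := 𝓘(ℂ, T))
    (I' := 𝓘(ℂ, A)) (fun _ : X => o) (fun z => f (z, o))
    (fun z => (mfderiv 𝓘(ℂ, T) 𝓘(ℂ, A) (fun t : S => f (z, t)) o : T →L[ℂ] A))
    (x₀ := z₀) (x := z) (mem_chart_source T o) (mem_chart_source A (f (z₀, o)))
  refine Eq.trans ?_ (congrArg (fun D : T →L[ℂ] A => D v) e1).symm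
  have e2 : (tangentBundleCore 𝓘(ℂ, T) S).coordChange (achart T o) (achart T o) o (v : T) =
      (v : T) := (tangentBundleCore 𝓘(ℂ, T) S).coordChange_self _ _ (mem_chart_source T o) _
  have e3 : ∀ w : A, (tangentBundleCore 𝓘(ℂ, A) A).coordChange (achart A (f (z, o)))
      (achart A (f (z₀, o))) (f (z, o)) w = w := fun w => by
    rw [tangentBundleCore_coordChange_model_space]; rfl
  exact ((e3 _).trans (congrArg (mfderiv 𝓘(ℂ, T) 𝓘(ℂ, A) (fun t : S => f (z, t)) o) e2)).symm

variable (r : ℕ)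
  (𝓔 : X × S → Type*) [∀ p, AddCommGroup (𝓔 p)] [∀ p, Module ℂ (𝓔 p)]
  [TopologicalSpace (TotalSpace (Fin r → ℂ) 𝓔)] [∀ p, TopologicalSpace (𝓔 p)]
  [FiberBundle (Fin r → ℂ) 𝓔] [VectorBundle ℂ (Fin r → ℂ) 𝓔]

/-- Coordinates of vectors in `𝓔 p` with respect to the preferred trivialization around `p₀`. -/
def coords (p₀ p : X × S) : 𝓔 p →ₗ[ℂ] (Fin r → ℂ) :=
  (trivializationAt (Fin r → ℂ) 𝓔 p₀).linearMapAt ℂ p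

/-- The inverse of `coords`: the vector in `𝓔 p` with given coordinates in the preferred
trivialization around `p₀`. -/
def frame (p₀ p : X × S) : (Fin r → ℂ) →ₗ[ℂ] 𝓔 p :=
  (trivializationAt (Fin r → ℂ) 𝓔 p₀).symmₗ ℂ p

/-- The matrix, as an endomorphism of `ℂ^r`, of a linear map `𝓔 p → 𝓔 q` with respect to the
preferred trivializations around `p₀` (source) and `q₀` (target). -/
def inTriv (p₀ q₀ p q : X × S) (φ : 𝓔 p →ₗ[ℂ] 𝓔 q) : (Fin r → ℂ) →L[ℂ] (Fin r → ℂ) :=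
  LinearMap.toContinuousLinearMap (coords r 𝓔 q₀ q ∘ₗ φ ∘ₗ frame r 𝓔 p₀ p)

variable (E) in
/-- The sheaf `End(𝓔₀)` of holomorphic endomorphisms of the central fibre `𝓔₀ = 𝓔|_{X × {o}}`. -/
def endSheaf (o : S) : SectionSheaf ℂ X (fun z => Module.End ℂ (𝓔 (z, o))) where
  at' x :=
    { carrier := {f | MDifferentiableAt 𝓘(ℂ, E) 𝓘(ℂ, (Fin r → ℂ) →L[ℂ] (Fin r → ℂ))
        (fun z => inTriv r 𝓔 (x, o) (x, o) (z, o) (z, o) (f z)) x}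
      zero_mem' := by
        refine (mdifferentiableAt_const (c := 0)).congr_of_eventuallyEq (.of_forall fun z => ?_)
        ext; simp [inTriv]
      add_mem' := by
        intro f g hf hg
        refine (hf.add hg).congr_of_eventuallyEq (.of_forall fun z => ?_)
        ext; simp [inTriv]
      smul_mem' := by
        intro a f hf
        refine (hf.const_smul a).congr_of_eventuallyEq (.of_forall fun z => ?_)
        ext; simp [inTriv] }
  congr' _ _ _ h hf := hf.congr_of_eventuallyEq (h.mono fun _ hy => by simp only [hy])

theorem frame_coords {p₀ p : X × S}
    (hp : p ∈ (trivializationAt (Fin r → ℂ) 𝓔 p₀).baseSet) (w : 𝓔 p) :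
    frame r 𝓔 p₀ p (coords r 𝓔 p₀ p w) = w :=
  (trivializationAt (Fin r → ℂ) 𝓔 p₀).symmₗ_linearMapAt hp w

theorem coords_frame {p₀ p : X × S}
    (hp : p ∈ (trivializationAt (Fin r → ℂ) 𝓔 p₀).baseSet) (u : Fin r → ℂ) :
    coords r 𝓔 p₀ p (frame r 𝓔 p₀ p u) = u :=
  (trivializationAt (Fin r → ℂ) 𝓔 p₀).linearMapAt_symmₗ hp u

/-- `coords` as a linear equivalence. -/
def coordsEquiv {p₀ p : X × S}
    (hp : p ∈ (trivializationAt (Fin r → ℂ) 𝓔 p₀).baseSet) : 𝓔 p ≃ₗ[ℂ] (Fin r → ℂ) :=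
  LinearEquiv.ofLinearMap (coords r 𝓔 p₀ p) (frame r 𝓔 p₀ p)
    (LinearMap.ext (coords_frame r 𝓔 hp)) (LinearMap.ext (frame_coords r 𝓔 hp))

set_option linter.unusedSectionVars false
theorem mem_base (p : X × S) : p ∈ (trivializationAt (Fin r → ℂ) 𝓔 p).baseSet :=
  FiberBundle.mem_baseSet_trivializationAt' p

theorem eventually_mem_base (x : X) (o : S) :
    ∀ᶠ z in 𝓝 x, (z, o) ∈ (trivializationAt (Fin r → ℂ) 𝓔 (x, o)).baseSet :=
  (Continuous.prodMk_left o).continuousAt.eventually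
    ((trivializationAt (Fin r → ℂ) 𝓔 (x, o)).open_baseSet.mem_nhds (mem_base r 𝓔 (x, o)))

variable (E) in
/-- The map `tr : H¹(X, End(𝓔₀)) → H¹(X, 𝒪_X)` induced by the trace. -/
def traceMap (o : S) : (endSheaf E r 𝓔 o).H1 →ₗ[ℂ] (structureSheaf E X).H1 :=
  SectionSheaf.H1.map (fun z => LinearMap.trace ℂ (𝓔 (z, o))) (fun x f hf => by
    let τ : ((Fin r → ℂ) →L[ℂ] (Fin r → ℂ)) →L[ℂ] ℂ := LinearMap.toContinuousLinearMap
      (LinearMap.trace ℂ (Fin r → ℂ) ∘ₗ LinearMap.toContinuousLinearMap.symm.toLinearMap)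
    have h1 : MDifferentiableAt 𝓘(ℂ, E) 𝓘(ℂ, ℂ)
        (fun z => τ (inTriv r 𝓔 (x, o) (x, o) (z, o) (z, o) (f z))) x :=
      (τ.differentiableAt.mdifferentiableAt).comp x hf
    refine h1.congr_of_eventuallyEq ?_
    filter_upwards [eventually_mem_base r 𝓔 x o] with z hz
    exact (LinearMap.trace_conj' (f z) (coordsEquiv r 𝓔 hz)).symm)

variable (E T) in
/-- Local trivializations of the deformation: an open cover `(U x)` of `X` and, for each index `x`,
an isomorphism `ψ_x : 𝓔 ≅ pr₁^* 𝓔₀` that is defined and holomorphic near `U x × {o}` and is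
the identity on `U x × {o}`. (Only the germ of `ψ_x` along `U x × {o}` matters.) -/
structure LocalTrivializations (o : S) where
  U : ∀ x : X, OpenNhdsOf x
  ψ : ∀ (_ z : X) (t : S), 𝓔 (z, t) ≃ₗ[ℂ] 𝓔 (z, o)
  eq_id : ∀ x z, z ∈ U x → ψ x z o = LinearEquiv.refl ℂ _
  holomorphic : ∀ x z₀, z₀ ∈ U x →
    ContMDiffAt (𝓘(ℂ, E).prod 𝓘(ℂ, T)) 𝓘(ℂ, (Fin r → ℂ) →L[ℂ] (Fin r → ℂ)) ω
      (fun p : X × S => inTriv r 𝓔 (z₀, o) (z₀, o) p (p.1, o) (ψ x p.1 p.2)) (z₀, o)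

namespace LocalTrivializations

variable {r} {𝓔} {o : S} (Ψ : LocalTrivializations E T r 𝓔 o)

/-- The transition automorphisms `θ_{xy}(z, t) = ψ_x ∘ ψ_y⁻¹` of the fibre of `𝓔₀` at `z`. -/
def θ (x y z : X) (t : S) : 𝓔 (z, o) ≃ₗ[ℂ] 𝓔 (z, o) :=
  (Ψ.ψ y z t).symm.trans (Ψ.ψ x z t)

/-- The coefficients `h_{xy}` of `θ_{xy}(z, ·) = Id + t h_{xy}(z) + ⋯`: the derivative of
`t ↦ θ_{xy}(z, t)` at `t = o` in the direction `v`, computed in coordinates of the fibre of `𝓔₀`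
at `z`. -/
def hCochain (v : TangentSpace 𝓘(ℂ, T) o) : X → X → ∀ z, Module.End ℂ (𝓔 (z, o)) :=
  fun x y z =>
    (coordsEquiv r 𝓔 (mem_base r 𝓔 (z, o))).symm.conj
      (dirDeriv v (fun t : S => inTriv r 𝓔 (z, o) (z, o) (z, o) (z, o) (Ψ.θ x y z t))).toLinearMap

/-- The matrix of `ψ_x` in the preferred trivializations around `(z₀, o)`. -/
def mat (x z₀ : X) (p : X × S) : (Fin r → ℂ) →L[ℂ] (Fin r → ℂ) :=
  inTriv r 𝓔 (z₀, o) (z₀, o) p (p.1, o) (Ψ.ψ x p.1 p.2)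

theorem hCochain_coords (v : TangentSpace 𝓘(ℂ, T) o) {x y z z₀ : X} (hx : z ∈ Ψ.U x)
    (hy : z ∈ Ψ.U y) (hz : (z, o) ∈ (trivializationAt (Fin r → ℂ) 𝓔 (z₀, o)).baseSet)
    (dx : MDifferentiableAt 𝓘(ℂ, T) 𝓘(ℂ, (Fin r → ℂ) →L[ℂ] (Fin r → ℂ))
      (fun t : S => Ψ.mat x z₀ (z, t)) o)
    (dy : MDifferentiableAt 𝓘(ℂ, T) 𝓘(ℂ, (Fin r → ℂ) →L[ℂ] (Fin r → ℂ))
      (fun t : S => Ψ.mat y z₀ (z, t)) o) :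
    inTriv r 𝓔 (z₀, o) (z₀, o) (z, o) (z, o) (Ψ.hCochain v x y z) =
      dirDeriv v (fun t => Ψ.mat x z₀ (z, t)) - dirDeriv v (fun t => Ψ.mat y z₀ (z, t)) := by
  have hQ := mem_base r 𝓔 (z, o)
  -- the constant change of coordinates in the fibre at `(z, o)`
  let A : (Fin r → ℂ) →L[ℂ] (Fin r → ℂ) := LinearMap.toContinuousLinearMap
    (coords r 𝓔 (z, o) (z, o) ∘ₗ frame r 𝓔 (z₀, o) (z, o))
  let B : (Fin r → ℂ) →L[ℂ] (Fin r → ℂ) := LinearMap.toContinuousLinearMap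
    (coords r 𝓔 (z₀, o) (z, o) ∘ₗ frame r 𝓔 (z, o) (z, o))
  have hone : ∀ w, z ∈ Ψ.U w → Ψ.mat w z₀ (z, o) = 1 := by
    intro w hw
    ext1 u
    simp [mat, inTriv, Ψ.eq_id w z hw, coords_frame r 𝓔 hz]
  have hev : ∀ᶠ t in 𝓝 o, (z, t) ∈ (trivializationAt (Fin r → ℂ) 𝓔 (z₀, o)).baseSet :=
    (Continuous.prodMk_right z).continuousAt.eventually
      ((trivializationAt (Fin r → ℂ) 𝓔 (z₀, o)).open_baseSet.mem_nhds hz)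
  have hfun : (fun t : S => inTriv r 𝓔 (z, o) (z, o) (z, o) (z, o) (Ψ.θ x y z t)) =ᶠ[𝓝 o]
      fun t => A * (Ψ.mat x z₀ (z, t) * Ring.inverse (Ψ.mat y z₀ (z, t))) * B := by
    filter_upwards [hev] with t ht
    have hi : Ring.inverse (Ψ.mat y z₀ (z, t)) = LinearMap.toContinuousLinearMap
        (coords r 𝓔 (z₀, o) (z, t) ∘ₗ (Ψ.ψ y z t).symm.toLinearMap ∘ₗ
          frame r 𝓔 (z₀, o) (z, o)) := by
      have h1 : (LinearMap.toContinuousLinearMap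
          (coords r 𝓔 (z₀, o) (z, t) ∘ₗ (Ψ.ψ y z t).symm.toLinearMap ∘ₗ
            frame r 𝓔 (z₀, o) (z, o))) * Ψ.mat y z₀ (z, t) = 1 := by
        ext1 u
        simp [mat, inTriv, frame_coords r 𝓔 hz, coords_frame r 𝓔 ht]
      have h2 : Ψ.mat y z₀ (z, t) * (LinearMap.toContinuousLinearMap
          (coords r 𝓔 (z₀, o) (z, t) ∘ₗ (Ψ.ψ y z t).symm.toLinearMap ∘ₗ
            frame r 𝓔 (z₀, o) (z, o))) = 1 := by
        ext1 u
        simp [mat, inTriv, frame_coords r 𝓔 ht, coords_frame r 𝓔 hz]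
      exact Ring.inverse_unit ⟨_, _, h2, h1⟩
    rw [hi]
    ext1 u
    simp [A, B, mat, inTriv, θ, frame_coords r 𝓔 hz, frame_coords r 𝓔 ht]
  have key : dirDeriv v (fun t : S => inTriv r 𝓔 (z, o) (z, o) (z, o) (z, o) (Ψ.θ x y z t)) =
      A * (dirDeriv v (fun t => Ψ.mat x z₀ (z, t)) - dirDeriv v (fun t => Ψ.mat y z₀ (z, t))) * B := by
    refine Eq.trans ?_ (dirDeriv_conj_mul_inverse v (hone x hx) (hone y hy) dx dy A B)
    exact congrArg (fun D : T →L[ℂ] ((Fin r → ℂ) →L[ℂ] (Fin r → ℂ)) => D v) hfun.mfderiv_eq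
  ext1 u
  rw [hCochain, key]
  simp [inTriv, A, B, coordsEquiv, LinearEquiv.conj_apply, frame_coords r 𝓔 hQ,
    coords_frame r 𝓔 hz]


theorem mat_contMDiffAt {x z₀ : X} (hx : z₀ ∈ Ψ.U x) :
    ContMDiffAt (𝓘(ℂ, E).prod 𝓘(ℂ, T)) 𝓘(ℂ, (Fin r → ℂ) →L[ℂ] (Fin r → ℂ)) ω
      (Ψ.mat x z₀) (z₀, o) :=
  Ψ.holomorphic x z₀ hx

variable [IsManifold 𝓘(ℂ, E) ω X] [IsManifold 𝓘(ℂ, T) ω S]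

theorem mat_eventually_mdifferentiable {x z₀ : X} (hx : z₀ ∈ Ψ.U x) :
    ∀ᶠ z in 𝓝 z₀, MDifferentiableAt 𝓘(ℂ, T) 𝓘(ℂ, (Fin r → ℂ) →L[ℂ] (Fin r → ℂ))
      (fun t : S => Ψ.mat x z₀ (z, t)) o := by
  have h1 : ∀ᶠ p in 𝓝 (z₀, o), ContMDiffAt (𝓘(ℂ, E).prod 𝓘(ℂ, T))
      𝓘(ℂ, (Fin r → ℂ) →L[ℂ] (Fin r → ℂ)) ω (Ψ.mat x z₀) p :=
    (contMDiffAt_iff_contMDiffAt_nhds (by simp)).1 (Ψ.mat_contMDiffAt hx)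
  have h2 := (Continuous.prodMk_left o).continuousAt.eventually h1
  filter_upwards [h2] with z hz
  exact (ContMDiffAt.comp o hz
    (contMDiffAt_const.prodMk contMDiffAt_id)).mdifferentiableAt (by simp)

theorem mat_dirDeriv_mdifferentiable (v : TangentSpace 𝓘(ℂ, T) o) {x z₀ : X} (hx : z₀ ∈ Ψ.U x) :
    MDifferentiableAt 𝓘(ℂ, E) 𝓘(ℂ, (Fin r → ℂ) →L[ℂ] (Fin r → ℂ))
      (fun z => dirDeriv v (fun t => Ψ.mat x z₀ (z, t))) z₀ := by
  exact mdifferentiableAt_dirDeriv v (Ψ.mat_contMDiffAt hx)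

/-- The `h_{xy}` are holomorphic sections of `End(𝓔₀)` and satisfy the cocycle condition. -/
theorem hCochain_mem (v : TangentSpace 𝓘(ℂ, T) o) :
    Ψ.hCochain v ∈ (endSheaf E r 𝓔 o).cocycles := by
  refine ⟨Ψ.U, fun x y z hx hy => ?_, fun x y w z hx hy hw => ?_⟩
  · refine ((Ψ.mat_dirDeriv_mdifferentiable v hx).sub
      (Ψ.mat_dirDeriv_mdifferentiable v hy)).congr_of_eventuallyEq ?_
    filter_upwards [eventually_mem_base r 𝓔 z o, Ψ.mat_eventually_mdifferentiable hx,
      Ψ.mat_eventually_mdifferentiable hy, (Ψ.U x).isOpen.mem_nhds hx,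
      (Ψ.U y).isOpen.mem_nhds hy] with p h1 h2 h3 h4 h5
    exact Ψ.hCochain_coords v h4 h5 h1 h2 h3
  · have hb := mem_base r 𝓔 (z, o)
    have dx := (Ψ.mat_eventually_mdifferentiable hx).self_of_nhds
    have dy := (Ψ.mat_eventually_mdifferentiable hy).self_of_nhds
    have dw := (Ψ.mat_eventually_mdifferentiable hw).self_of_nhds
    have inj : ∀ φ φ' : Module.End ℂ (𝓔 (z, o)),
        inTriv r 𝓔 (z, o) (z, o) (z, o) (z, o) φ = inTriv r 𝓔 (z, o) (z, o) (z, o) (z, o) φ' →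
        φ = φ' := by
      intro φ φ' h
      have h' := LinearMap.toContinuousLinearMap.injective h
      exact (coordsEquiv r 𝓔 hb).conj.injective h'
    apply inj
    have hadd : ∀ φ φ' : Module.End ℂ (𝓔 (z, o)),
        inTriv r 𝓔 (z, o) (z, o) (z, o) (z, o) (φ + φ') = inTriv r 𝓔 (z, o) (z, o) (z, o) (z, o) φ
          + inTriv r 𝓔 (z, o) (z, o) (z, o) (z, o) φ' := by
      intro φ φ'; ext; simp [inTriv]
    rw [hadd, Ψ.hCochain_coords v hx hy hb dx dy, Ψ.hCochain_coords v hy hw hb dy dw,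
      Ψ.hCochain_coords v hx hw hb dx dw, sub_add_sub_cancel]

/-- The infinitesimal (Kodaira–Spencer) class `h ∈ H¹(X, End(𝓔₀))` of the deformation in the
direction `v`. -/
def hClass (v : TangentSpace 𝓘(ℂ, T) o) : (endSheaf E r 𝓔 o).H1 :=
  SectionSheaf.H1.mk _ ⟨Ψ.hCochain v, Ψ.hCochain_mem v⟩

end LocalTrivializations

variable (E T) in
/-- A holomorphic vector bundle on `X × S` admits local trivializations as above. -/
theorem nonempty_localTrivializations
    [IsManifold 𝓘(ℂ, E) ω X] [IsManifold 𝓘(ℂ, T) ω S]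
    [ContMDiffVectorBundle ω (Fin r → ℂ) 𝓔 (𝓘(ℂ, E).prod 𝓘(ℂ, T))] (o : S) :
    Nonempty (LocalTrivializations E T r 𝓔 o) := by
  classical
  let e : X × S → Trivialization (Fin r → ℂ) (π (Fin r → ℂ) 𝓔) :=
    fun p => trivializationAt (Fin r → ℂ) 𝓔 p
  refine ⟨⟨fun x => ⟨⟨{z | (z, o) ∈ (e (x, o)).baseSet}, (e (x, o)).open_baseSet.preimage
    (Continuous.prodMk_left o)⟩, mem_base r 𝓔 (x, o)⟩,
    fun x z t => if h : (z, t) ∈ (e (x, o)).baseSet ∧ (z, o) ∈ (e (x, o)).baseSet then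
      (coordsEquiv r 𝓔 h.1).trans (coordsEquiv r 𝓔 h.2).symm else
      (coordsEquiv r 𝓔 (mem_base r 𝓔 (z, t))).trans (coordsEquiv r 𝓔 (mem_base r 𝓔 (z, o))).symm,
    ?_, ?_⟩⟩
  · intro x z hz
    have hz' : (z, o) ∈ (e (x, o)).baseSet := hz
    rw [dif_pos ⟨hz', hz'⟩, LinearEquiv.self_trans_symm]
  · intro x z₀ hz
    have hz' : (z₀, o) ∈ (e (x, o)).baseSet := hz
    have hz0 : (z₀, o) ∈ (e (z₀, o)).baseSet := mem_base r 𝓔 (z₀, o)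
    have c1 := contMDiffAt_coordChangeL (n := ω) (IB := 𝓘(ℂ, E).prod 𝓘(ℂ, T))
      (e := e (z₀, o)) (e' := e (x, o)) hz0 hz'
    have c2 := contMDiffAt_coordChangeL (n := ω) (IB := 𝓘(ℂ, E).prod 𝓘(ℂ, T))
      (e := e (x, o)) (e' := e (z₀, o)) hz' hz0
    have hπ : ContMDiffAt (𝓘(ℂ, E).prod 𝓘(ℂ, T)) (𝓘(ℂ, E).prod 𝓘(ℂ, T)) ω
        (fun p : X × S => (p.1, o)) (z₀, o) := contMDiffAt_fst.prodMk contMDiffAt_const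
    have c3 := ContMDiffAt.comp (z₀, o) (g := fun b : X × S =>
      ((e (x, o)).coordChangeL ℂ (e (z₀, o)) b : (Fin r → ℂ) →L[ℂ] (Fin r → ℂ))) c2 hπ
    have hπ' : Filter.Tendsto (fun p : X × S => (p.1, o)) (𝓝 (z₀, o)) (𝓝 (z₀, o)) :=
      hπ.continuousAt
    refine (c3.clm_comp c1).congr_of_eventuallyEq ?_
    have b1 := (e (x, o)).open_baseSet.mem_nhds hz'
    have b2 := (e (z₀, o)).open_baseSet.mem_nhds hz0
    filter_upwards [b1, b2, hπ'.eventually b1, hπ'.eventually b2] with p h1 h2 h3 h4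
    ext1 u
    simp only [Function.comp_apply, ContinuousLinearMap.comp_apply,
      ContinuousLinearEquiv.coe_coe]
    rw [Trivialization.coordChangeL_apply _ _ ⟨h2, h1⟩,
      Trivialization.coordChangeL_apply _ _ ⟨h3, h4⟩, dif_pos ⟨h1, h3⟩]
    have k1 : (e (z₀, o)).symm p u = frame r 𝓔 (z₀, o) p u :=
      ((e (z₀, o)).symmₗ_apply (R := ℂ) h2 u).symm
    have k2 : ∀ y : 𝓔 p, (e (x, o) ⟨p, y⟩).2 = coords r 𝓔 (x, o) p y := fun y =>
      (congrFun ((e (x, o)).coe_linearMapAt_of_mem (R := ℂ) h1) y).symm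
    have k3 : ∀ y, (e (x, o)).symm (p.1, o) y = frame r 𝓔 (x, o) (p.1, o) y := fun y =>
      ((e (x, o)).symmₗ_apply (R := ℂ) h3 y).symm
    have k4 : ∀ y : 𝓔 (p.1, o), (e (z₀, o) ⟨(p.1, o), y⟩).2 = coords r 𝓔 (z₀, o) (p.1, o) y :=
      fun y => (congrFun ((e (z₀, o)).coe_linearMapAt_of_mem (R := ℂ) h4) y).symm
    rw [k1, k2, k3, k4]
    rfl

/-! ### Hermitian metrics and Ricci curvature -/

variable (E T) in
/-- A (smooth) hermitian metric on the bundle `𝓔` over `X × S`. -/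
structure HermitianMetric where
  form : ∀ p, 𝓔 p →ₗ⋆[ℂ] 𝓔 p →ₗ[ℂ] ℂ
  conj_symm : ∀ p v w, conj (form p v w) = form p w v
  pos : ∀ p v, v ≠ 0 → 0 < (form p v v).re
  smooth : ∀ (p₀ : X × S) (u w : Fin r → ℂ),
    ContMDiffAt (𝓘(ℝ, E).prod 𝓘(ℝ, T)) 𝓘(ℝ, ℂ) ∞
      (fun p => form p (frame r 𝓔 p₀ p u) (frame r 𝓔 p₀ p w)) p₀

/-- The Wirtinger derivative `∂_v f = (D_v f - i D_{iv} f) / 2` of `f : E → ℂ`. -/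
def wirtinger (v : E) (f : E → ℂ) (a : E) : ℂ :=
  (fderiv ℝ f a v - Complex.I * fderiv ℝ f a (Complex.I • v)) / 2

/-- The Wirtinger derivative `∂̄_v f = (D_v f + i D_{iv} f) / 2` of `f : E → ℂ`. -/
def wirtingerBar (v : E) (f : E → ℂ) (a : E) : ℂ :=
  (fderiv ℝ f a v + Complex.I * fderiv ℝ f a (Complex.I • v)) / 2

/-- The `(1,1)`-form `∂∂̄ f`, evaluated at the point `a` on the vectors `v` and `w`: for
`E = ℂ^n` this is `∑ ∂²f/∂z_j∂z̄_k dz_j ∧ dz̄_k`. -/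
def ddbar (f : E → ℂ) (a v w : E) : ℂ :=
  wirtinger v (wirtingerBar w f) a - wirtinger w (wirtingerBar v f) a

namespace HermitianMetric

variable {r} {𝓔} (g : HermitianMetric E T r 𝓔)

/-- `log det g` at `p`, where `det g` is the determinant of the Gram matrix of `g` with respect to
the holomorphic frame given by the preferred trivialization around `p₀`. -/
def logDet (p₀ p : X × S) : ℝ :=
  Real.log (Matrix.det (Matrix.of fun j k : Fin r =>
    g.form p (frame r 𝓔 p₀ p (Pi.single j 1)) (frame r 𝓔 p₀ p (Pi.single k 1)))).re

/-- The Ricci curvature form `Θ^t = ∂_X ∂̄_X log det g|_{𝓔_t}` at `x`, evaluated on tangent vectors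
`v, w` of `X` at `x`. It is computed in the preferred chart at `x`, through which Mathlib identifies
the tangent space at `x` with `E`. -/
def ricciForm (t : S) (x : X) (v w : TangentSpace 𝓘(ℂ, E) x) : ℂ :=
  ddbar (fun a : E => (g.logDet (x, t) ((chartAt E x).symm a, t) : ℂ)) (chartAt E x x) v w

/-- The deformation `(𝓔, g)` over `(S, o)` is Ricci-flat if `Θ^t = Θ^o` for all `t`. -/
def IsRicciFlat (o : S) : Prop :=
  ∀ (t : S) (x : X) (v w : TangentSpace 𝓘(ℂ, E) x), g.ricciForm t x v w = g.ricciForm o x v w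

end HermitianMetric

end Deformation

end RicciFlat

end

namespace RicciFlat

/-! ### Pluriharmonic functions -/

section SecondDerivative

variable {P : Type*} [NormedAddCommGroup P] [NormedSpace ℝ P]

/-! The isomorphisms `ψ_x` transport the metric on `𝓔_t` to a metric on `𝓔₀`, and the argument
compares the logarithmic derivatives of these volume forms at `o`. Let `u_x` be the derivative at
`o`, in the direction `v`, of `log det` of the metric transported by `ψ_x`. A change of frame of
`𝓔₀` multiplies the Gram determinant by a factor independent of `t`, so `u_x` is a well-defined real
function on `U x`. The metrics transported by `ψ_x` and `ψ_y` differ by `θ_{xy}`, hence `2 Re tr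
h_{xy} = u_y - u_x` (`re_trace_hCochain`).

In a holomorphic frame, `u_x = ∂_v log det g - 2 Re tr ∂_v ψ_x` (`transportDeriv_eq`). The last term
is the real part of a holomorphic function. By Ricci-flatness `∂∂̄ log det g` does not depend on
`t`, so `∂_v log det g` is pluriharmonic (`pluriharmonicAt_fderiv_parameter`) and is locally the
real part of a holomorphic function (`exists_differentiable_re_eq`). Thus `u_x / 2 = Re q_x` near
`x` with `q_x` holomorphic.

Now `tr h_{xy} - (q_y - q_x)` is holomorphic with zero real part, hence locally constant and
imaginary. Divided by `2πi` it is a real locally constant cocycle, so `tr h / (2πi)` lies in `i_*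
H¹(X, ℝ)` (`smul_mk_mem_range_iStar`). This holds for every tangent vector, in particular for all `c
• v` with `c` complex, and `h` scales with `c` (`hClass_smul`). The whole complex line through the
class therefore lies in `i_* H¹(X, ℝ)`, so it lies in `V`. -/

theorem hasFDerivAt_fderiv_apply {G : P → ℝ} {p : P} (hG : ContDiffAt ℝ 2 G p) (w : P) :
    HasFDerivAt (fun q => fderiv ℝ G q w) ((fderiv ℝ (fderiv ℝ G) p).flip w) p := by
  have hD : HasFDerivAt (fderiv ℝ G) (fderiv ℝ (fderiv ℝ G) p) p :=
    ((hG.fderiv_right (m := 1) (by norm_num)).differentiableAt (by simp)).hasFDerivAt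
  refine (hD.clm_apply (hasFDerivAt_const w p)).congr_fderiv ?_
  ext u
  simp

end SecondDerivative

section Pluriharmonic

variable {E : Type*} [NormedAddCommGroup E] [NormedSpace ℂ E]
  {F : Type*} [NormedAddCommGroup F] [NormedSpace ℂ F]

/-- The condition `∂∂̄ f = 0` at `a`, expressed through the second real derivative of `f`. -/
def PluriharmonicAt (f : E → ℝ) (a : E) : Prop :=
  ∀ u w, fderiv ℝ (fderiv ℝ f) a (Complex.I • u) w = fderiv ℝ (fderiv ℝ f) a u (Complex.I • w)

/-- With `H` the real Hessian, `∂_v ∂̄_w f` is a quarter of `H(v,w) + H(iv,iw) + i (H(v,iw) -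
H(iv,w))`. By symmetry of `H` the first two terms cancel in the antisymmetrization and the other two
double. -/
theorem ddbar_ofReal {f : E → ℝ} {a : E} (hf : ContDiffAt ℝ 2 f a) (v w : E) :
    ddbar (fun b => (f b : ℂ)) a v w = Complex.I / 2 *
      ((fderiv ℝ (fderiv ℝ f) a v (Complex.I • w) : ℝ) -
        (fderiv ℝ (fderiv ℝ f) a (Complex.I • v) w : ℝ)) := by
  have hd : ∀ᶠ b in 𝓝 a, DifferentiableAt ℝ f b :=
    (hf.eventually (by simp)).mono fun b hb => hb.differentiableAt (by simp)
  have hsym : IsSymmSndFDerivAt ℝ f a := hf.isSymmSndFDerivAt (by simp)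
  have h1 : ∀ w, wirtingerBar w (fun b => (f b : ℂ)) =ᶠ[𝓝 a] fun b =>
      ((fderiv ℝ f b w : ℝ) + Complex.I * (fderiv ℝ f b (Complex.I • w) : ℝ)) / 2 := by
    intro w
    filter_upwards [hd] with b hb
    have h : HasFDerivAt (fun b => (f b : ℂ)) (Complex.ofRealCLM.comp (fderiv ℝ f b)) b :=
      Complex.ofRealCLM.hasFDerivAt.comp b hb.hasFDerivAt
    simp [wirtingerBar, h.fderiv]
  have h2 : ∀ v w, fderiv ℝ (wirtingerBar w (fun b => (f b : ℂ))) a v =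
      ((fderiv ℝ (fderiv ℝ f) a v w : ℝ) +
        Complex.I * (fderiv ℝ (fderiv ℝ f) a v (Complex.I • w) : ℝ)) / 2 := by
    intro v w
    rw [(h1 w).fderiv_eq]
    have e : ∀ w, HasFDerivAt (fun b => ((fderiv ℝ f b w : ℝ) : ℂ))
        (Complex.ofRealCLM.comp ((fderiv ℝ (fderiv ℝ f) a).flip w)) a := fun w =>
      Complex.ofRealCLM.hasFDerivAt.comp a (hasFDerivAt_fderiv_apply hf w)
    have := ((e w).add ((e (Complex.I • w)).const_mul Complex.I)).mul_const (2⁻¹ : ℂ)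
    simp only [div_eq_mul_inv]
    erw [this.fderiv]
    simp
    ring
  have s := fun u w => hsym.eq u w
  simp only [ddbar, wirtinger, h2]
  rw [s w v, s w (Complex.I • v), s (Complex.I • w) v, s (Complex.I • w) (Complex.I • v)]
  ring

theorem PluriharmonicAt.congr {f g : E → ℝ} {a : E} (hf : PluriharmonicAt f a) (h : f =ᶠ[𝓝 a] g) :
    PluriharmonicAt g a := by
  unfold PluriharmonicAt
  rw [← h.fderiv.fderiv_eq]
  exact hf

theorem PluriharmonicAt.add {f g : E → ℝ} {a : E} (hf : PluriharmonicAt f a)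
    (hg : PluriharmonicAt g a) (cf : ContDiffAt ℝ 2 f a) (cg : ContDiffAt ℝ 2 g a) :
    PluriharmonicAt (fun b => f b + g b) a := by
  have h : fderiv ℝ (fun b => f b + g b) =ᶠ[𝓝 a] fun b => fderiv ℝ f b + fderiv ℝ g b := by
    filter_upwards [cf.eventually (by simp), cg.eventually (by simp)] with b h1 h2
    exact fderiv_add (h1.differentiableAt (by simp)) (h2.differentiableAt (by simp))
  intro u w
  rw [h.fderiv_eq, fderiv_fun_add ((cf.fderiv_right (m := 1) (by norm_num)).differentiableAt (by simp))
    ((cg.fderiv_right (m := 1) (by norm_num)).differentiableAt (by simp))]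
  simp [hf u w, hg u w]

theorem PluriharmonicAt.neg {f : E → ℝ} {a : E} (hf : PluriharmonicAt f a) :
    PluriharmonicAt (fun b => - f b) a := by
  have h : fderiv ℝ (fun b => - f b) = fun b => - fderiv ℝ f b := by
    ext1 b; exact fderiv_fun_neg
  intro u w
  rw [h, fderiv_fun_neg]
  simp [hf u w]

theorem PluriharmonicAt.sub {f g : E → ℝ} {a : E} (hf : PluriharmonicAt f a)
    (hg : PluriharmonicAt g a) (cf : ContDiffAt ℝ 2 f a) (cg : ContDiffAt ℝ 2 g a) :
    PluriharmonicAt (fun b => f b - g b) a := by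
  simpa only [sub_eq_add_neg] using hf.add hg.neg cf cg.neg

/-- Two functions with the same `∂∂̄` differ by a pluriharmonic function. -/
theorem pluriharmonicAt_sub_of_ddbar_eq {f g : E → ℝ} {a : E} (cf : ContDiffAt ℝ 2 f a)
    (cg : ContDiffAt ℝ 2 g a)
    (h : ∀ v w, ddbar (fun b => (f b : ℂ)) a v w = ddbar (fun b => (g b : ℂ)) a v w) :
    PluriharmonicAt (fun b => f b - g b) a := by
  have h' : fderiv ℝ (fun b => f b - g b) =ᶠ[𝓝 a] fun b => fderiv ℝ f b - fderiv ℝ g b := by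
    filter_upwards [cf.eventually (by simp), cg.eventually (by simp)] with b h1 h2
    exact fderiv_sub (h1.differentiableAt (by simp)) (h2.differentiableAt (by simp))
  intro u w
  rw [h'.fderiv_eq, fderiv_fun_sub
    ((cf.fderiv_right (m := 1) (by norm_num)).differentiableAt (by simp))
    ((cg.fderiv_right (m := 1) (by norm_num)).differentiableAt (by simp))]
  have k := h u w
  rw [ddbar_ofReal cf, ddbar_ofReal cg] at k
  have k' := mul_left_cancel₀ (div_ne_zero Complex.I_ne_zero two_ne_zero) k
  have k'' : fderiv ℝ (fderiv ℝ f) a u (Complex.I • w) - fderiv ℝ (fderiv ℝ f) a (Complex.I • u) w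
    = fderiv ℝ (fderiv ℝ g) a u (Complex.I • w) - fderiv ℝ (fderiv ℝ g) a (Complex.I • u) w := by
    exact_mod_cast k'
  simp only [sub_apply]
  linarith

/-- Pluriharmonicity is preserved by holomorphic pullback. -/
theorem PluriharmonicAt.comp {f : F → ℝ} {h : E → F} {a : E} (hf : PluriharmonicAt f (h a))
    (cf : ContDiffAt ℝ 2 f (h a)) (ch : ContDiffAt ℂ 2 h a) :
    PluriharmonicAt (fun b => f (h b)) a := by
  have chR : ContDiffAt ℝ 2 h a := ch.restrict_scalars ℝ
  have e1 : fderiv ℝ (fun b => f (h b)) =ᶠ[𝓝 a]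
      fun b => (fderiv ℝ f (h b)).comp (fderiv ℝ h b) := by
    filter_upwards [ch.continuousAt.eventually (cf.eventually (by simp)),
      chR.eventually (by simp)] with b h1 h2
    exact fderiv_comp b (h1.differentiableAt (by simp)) (h2.differentiableAt (by simp))
  have e2 : fderiv ℝ h =ᶠ[𝓝 a]
      fun b => ContinuousLinearMap.restrictScalarsL ℂ E F ℝ ℝ (fderiv ℂ h b) := by
    filter_upwards [ch.eventually (by simp)] with b hb
    exact (hb.differentiableAt (by simp)).fderiv_restrictScalars ℝ
  have dH : HasFDerivAt (fderiv ℂ h) ((fderiv ℂ (fderiv ℂ h) a).restrictScalars ℝ) a :=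
    ((ch.fderiv_right (m := 1) (by norm_num)).differentiableAt
      (by simp)).hasFDerivAt.restrictScalars ℝ
  have d2 := ((ContinuousLinearMap.restrictScalarsL ℂ E F ℝ ℝ).hasFDerivAt.comp a
    dH).congr_of_eventuallyEq e2
  have d1 : HasFDerivAt (fderiv ℝ f) (fderiv ℝ (fderiv ℝ f) (h a)) (h a) :=
    ((cf.fderiv_right (m := 1) (by norm_num)).differentiableAt (by simp)).hasFDerivAt
  have d3 := (d1.comp a (chR.differentiableAt (by simp)).hasFDerivAt).clm_comp d2
  intro u w
  rw [e1.fderiv_eq]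
  erw [d3.fderiv]
  -- The second derivative is `f''(h'u, h'w) + f'(h''(u, w))`. Since `h'` is complex linear,
  -- pluriharmonicity of `f` handles the first term. Since `h''` is complex bilinear, `i` passes
  -- from one argument to the other in the second.
  have hI : ∀ u, fderiv ℝ h a (Complex.I • u) = Complex.I • fderiv ℝ h a u := by
    intro u
    rw [e2.self_of_nhds]
    simp
  simp [hI, hf _ _]

theorem pluriharmonicAt_re (a : ℂ) : PluriharmonicAt Complex.re a := by
  have h : fderiv ℝ Complex.re = fun _ => Complex.reCLM := by
    ext1 b; exact Complex.reCLM.fderiv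
  intro u w
  rw [h]
  simp

/-- Dividing by `d a` moves the value at `a` to `1`, away from the branch cut, so the principal
logarithm is holomorphic near `a`. The constant restores the lost factor. -/
theorem log_normSq_eventuallyEq {A : Type*} [TopologicalSpace A] {d : A → ℂ} {a : A}
    (cd : ContinuousAt d a) (h0 : d a ≠ 0) :
    (fun b => Real.log (Complex.normSq (d b))) =ᶠ[𝓝 a]
      fun b => (2 * Complex.log (d b / d a) + (Real.log (Complex.normSq (d a)) : ℂ)).re := by
  filter_upwards [cd.eventually_ne h0] with b hb
  rw [Complex.add_re, Complex.ofReal_re]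
  have : (2 * Complex.log (d b / d a)).re = Real.log (Complex.normSq (d b / d a)) := by
    rw [Complex.normSq_eq_norm_sq, Real.log_pow, ← Complex.log_re]
    simp
  rw [this, Complex.normSq_div, Real.log_div (by simpa using hb) (by simpa using h0)]
  ring

theorem contDiffAt_log_div {d : E → ℂ} {a : E} {n : ℕ∞ω} (cd : ContDiffAt ℂ n d a) (h0 : d a ≠ 0) :
    ContDiffAt ℂ n (fun b => 2 * Complex.log (d b / d a) +
      (Real.log (Complex.normSq (d a)) : ℂ)) a := by
  have h1 : ContDiffAt ℂ n (fun b => d b / d a) a := cd.div_const _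
  have h2 : ContDiffAt ℂ n (fun b => Complex.log (d b / d a)) a :=
    (Complex.contDiffAt_log (by simp [h0])).comp a h1
  exact (contDiffAt_const.mul h2).add contDiffAt_const

theorem contDiffAt_log_normSq {d : E → ℂ} {a : E} {n : ℕ∞ω} (cd : ContDiffAt ℂ n d a)
    (h0 : d a ≠ 0) : ContDiffAt ℝ n (fun b => Real.log (Complex.normSq (d b))) a :=
  (Complex.reCLM.contDiff.contDiffAt.comp a
    ((contDiffAt_log_div cd h0).restrict_scalars ℝ)).congr_of_eventuallyEq
      (log_normSq_eventuallyEq cd.continuousAt h0)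

theorem pluriharmonicAt_log_normSq {d : E → ℂ} {a : E} (cd : ContDiffAt ℂ 2 d a) (h0 : d a ≠ 0) :
    PluriharmonicAt (fun b => Real.log (Complex.normSq (d b))) a :=
  ((pluriharmonicAt_re _).comp Complex.reCLM.contDiff.contDiffAt
    (contDiffAt_log_div cd h0)).congr (log_normSq_eventuallyEq cd.continuousAt h0).symm

theorem hasFDerivAt_log_normSq {d : E → ℂ} {a : E} (dd : DifferentiableAt ℂ d a) (h1 : d a = 1) :
    HasFDerivAt (fun b => Real.log (Complex.normSq (d b)))
      ((2 : ℝ) • Complex.reCLM.comp ((fderiv ℂ d a).restrictScalars ℝ)) a := by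
  have h0 : d a ≠ 0 := by simp [h1]
  have e := log_normSq_eventuallyEq dd.continuousAt h0
  have h2 : HasFDerivAt (fun b => Complex.log (d b / d a)) ((1 : ℂ) • fderiv ℂ d a) a := by
    have := dd.hasFDerivAt.clog (by simp [h1])
    simpa [h1] using this
  have h3 := ((h2.const_mul 2).add_const (Real.log (Complex.normSq (d a)) : ℂ)).restrictScalars ℝ
  refine ((Complex.reCLM.hasFDerivAt.comp a h3).congr_of_eventuallyEq e).congr_fderiv ?_
  ext u
  simp

/-- A pluriharmonic function is locally the real part of a holomorphic function. -/
theorem exists_differentiable_re_eq {φ : E → ℝ} {a₀ : E}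
    (h : ∀ᶠ a in 𝓝 a₀, ContDiffAt ℝ 2 φ a ∧ PluriharmonicAt φ a) :
    ∃ f : E → ℂ, ∀ᶠ a in 𝓝 a₀, DifferentiableAt ℂ f a ∧ (f a).re = φ a := by
  obtain ⟨ε, hε, hB⟩ := Metric.eventually_nhds_iff_ball.1 h
  -- `Λ l` is the complex linear functional with real part `l`, so `Λ ∘ dφ` is the form `2∂φ`, whose
  -- primitive should be `f`.
  let Λ : (E →L[ℝ] ℝ) →L[ℝ] (E →L[ℂ] ℂ) :=
    (StrongDual.extendRCLikeL (𝕜 := ℂ) (F := E)).toContinuousLinearMap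
  have hΛ : ∀ (l : E →L[ℝ] ℝ) w, Λ l w = (l w : ℂ) - Complex.I * (l (Complex.I • w) : ℂ) :=
    fun l w => StrongDual.extendRCLike_apply (𝕜 := ℂ) l w
  have hd : ∀ a ∈ Metric.ball a₀ ε, HasFDerivAt (fun b => Λ (fderiv ℝ φ b))
      (Λ.comp (fderiv ℝ (fderiv ℝ φ) a)) a := fun a ha =>
    Λ.hasFDerivAt.comp a (((hB a ha).1.fderiv_right (m := 1) (by norm_num)).differentiableAt
      (by simp)).hasFDerivAt
  -- Poincaré lemma on the ball. Closedness of `Λ ∘ dφ` has as real part the symmetry of the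
  -- Hessian, and as imaginary part, given that symmetry, the pluriharmonicity of `φ`.
  obtain ⟨f, hf⟩ := (convex_ball a₀ ε).exists_forall_hasFDerivAt_of_fderiv_symmetric
    Metric.isOpen_ball (fun a ha => (hd a ha).differentiableAt.differentiableWithinAt) (by
      intro a ha x y
      have hsym : IsSymmSndFDerivAt ℝ φ a := (hB a ha).1.isSymmSndFDerivAt (by simp)
      rw [(hd a ha).fderiv]
      simp only [ContinuousLinearMap.comp_apply, hΛ]
      rw [hsym.eq x y, ← (hB a ha).2 x y, hsym.eq (Complex.I • x) y])
  have hre : ∀ a ∈ Metric.ball a₀ ε, HasFDerivAt (fun b => (f b).re - φ b) (0 : E →L[ℝ] ℝ) a := by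
    intro a ha
    have h1 := (Complex.reCLM.hasFDerivAt.comp a ((hf a ha).restrictScalars ℝ)).sub
      ((hB a ha).1.differentiableAt (by simp)).hasFDerivAt
    refine h1.congr_fderiv ?_
    ext u
    simp [hΛ]
  have hc : ∀ a ∈ Metric.ball a₀ ε, (f a).re - φ a = (f a₀).re - φ a₀ := fun a ha =>
    Metric.isOpen_ball.is_const_of_fderiv_eq_zero (𝕜 := ℝ) (convex_ball a₀ ε).isPreconnected
      (fun b hb => (hre b hb).differentiableAt.differentiableWithinAt)
      (fun b hb => (hre b hb).fderiv) ha (Metric.mem_ball_self hε)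
  refine ⟨fun a => f a - ((f a₀).re - φ a₀ : ℝ), ?_⟩
  filter_upwards [Metric.ball_mem_nhds a₀ hε] with a ha
  refine ⟨(hf a ha).differentiableAt.sub_const _, ?_⟩
  rw [Complex.sub_re, Complex.ofReal_re, ← hc a ha]
  ring

/-- A holomorphic function with vanishing real part is locally constant. -/
theorem eventually_eq_of_re_eq_zero {f : E → ℂ} {a₀ : E}
    (h : ∀ᶠ a in 𝓝 a₀, DifferentiableAt ℂ f a ∧ (f a).re = 0) : ∀ᶠ a in 𝓝 a₀, f a = f a₀ := by
  obtain ⟨ε, hε, hB⟩ := Metric.eventually_nhds_iff_ball.1 h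
  have hz : ∀ a ∈ Metric.ball a₀ ε, fderiv ℂ f a = 0 := by
    intro a ha
    have h1 := Complex.reCLM.hasFDerivAt.comp a ((hB a ha).1.hasFDerivAt.restrictScalars ℝ)
    have h2 : (fun b => (f b).re) =ᶠ[𝓝 a] fun _ => 0 := by
      filter_upwards [Metric.isOpen_ball.mem_nhds ha] with b hb using (hB b hb).2
    have h3 := h1.unique ((hasFDerivAt_const (0 : ℝ) a).congr_of_eventuallyEq h2)
    have h4 : ∀ u, (fderiv ℂ f a u).re = 0 := fun u => congrArg (fun l : E →L[ℝ] ℝ => l u) h3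
    ext u
    refine Complex.ext (h4 u) ?_
    -- `Re f'(iu) = -Im f'(u)`, so the vanishing of all real parts kills the imaginary parts too.
    have := h4 (Complex.I • u)
    simpa using this
  filter_upwards [Metric.ball_mem_nhds a₀ hε] with a ha
  exact Metric.isOpen_ball.is_const_of_fderiv_eq_zero (𝕜 := ℂ) (convex_ball a₀ ε).isPreconnected
    (fun b hb => (hB b hb).1.differentiableWithinAt) hz ha (Metric.mem_ball_self hε)

end Pluriharmonic

/-! ### Derivatives with respect to a parameter -/

section Parameters

variable {P : Type*} [NormedAddCommGroup P] [NormedSpace ℝ P]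

theorem fderiv_fderiv_apply {G : P → ℝ} {p : P} (hG : ContDiffAt ℝ 2 G p) (u w : P) :
    fderiv ℝ (fun q => fderiv ℝ G q w) p u = fderiv ℝ (fderiv ℝ G) p u w := by
  rw [(hasFDerivAt_fderiv_apply hG w).fderiv]
  rfl

theorem fderiv_fderiv_comm {G : P → ℝ} {p : P} (hG : ContDiffAt ℝ 2 G p) (u w : P) :
    fderiv ℝ (fun q => fderiv ℝ G q w) p u = fderiv ℝ (fun q => fderiv ℝ G q u) p w := by
  rw [fderiv_fderiv_apply hG, fderiv_fderiv_apply hG]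
  exact (hG.isSymmSndFDerivAt (by simp)).eq u w

theorem ContDiffAt.fderiv_apply_const {G : P → ℝ} {p : P} {m n : ℕ∞ω} (hG : ContDiffAt ℝ n G p)
    (hmn : m + 1 ≤ n) (w : P) : ContDiffAt ℝ m (fun q => fderiv ℝ G q w) p :=
  (hG.fderiv_right hmn).clm_apply contDiffAt_const

/-- Two transpositions cycle the order of differentiation. This exchanges a parameter derivative
taken last for one taken first. -/
theorem fderiv_fderiv_fderiv_comm {G : P → ℝ} {p : P} (hG : ContDiffAt ℝ 3 G p) (u v w : P) :
    fderiv ℝ (fun q => fderiv ℝ (fun q => fderiv ℝ G q w) q u) p v =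
      fderiv ℝ (fun q => fderiv ℝ (fun q => fderiv ℝ G q v) q w) p u := by
  rw [fderiv_fderiv_comm (ContDiffAt.fderiv_apply_const hG (m := 2) (by norm_num) w) v u]
  have h : (fun q => fderiv ℝ (fun q => fderiv ℝ G q w) q v) =ᶠ[𝓝 p]
      fun q => fderiv ℝ (fun q => fderiv ℝ G q v) q w := by
    filter_upwards [hG.eventually (by simp)] with q hq
    exact fderiv_fderiv_comm (hq.of_le (by norm_num)) v w
  rw [h.fderiv_eq]

variable {E : Type*} [NormedAddCommGroup E] [NormedSpace ℂ E]
  {T : Type*} [NormedAddCommGroup T] [NormedSpace ℂ T]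

theorem contDiffAt_slice {G : E × T → ℝ} {a : E} {b : T} {n : ℕ∞ω} (hG : ContDiffAt ℝ n G (a, b)) :
    ContDiffAt ℝ n (fun a' => G (a', b)) a :=
  hG.comp a (contDiffAt_id.prodMk contDiffAt_const)

theorem fderiv_slice {G : E × T → ℝ} {a : E} {b : T} (hG : DifferentiableAt ℝ G (a, b)) (w : E) :
    fderiv ℝ (fun a' => G (a', b)) a w = fderiv ℝ G (a, b) (w, 0) := by
  have h : HasFDerivAt (fun a' => G (a', b)) ((fderiv ℝ G (a, b)).comp
      (ContinuousLinearMap.inl ℝ E T)) a :=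
    hG.hasFDerivAt.comp a (hasFDerivAt_prodMk_left a b)
  rw [h.fderiv]
  simp

theorem fderiv_fderiv_slice {G : E × T → ℝ} {a : E} {b : T} (hG : ContDiffAt ℝ 2 G (a, b))
    (u w : E) : fderiv ℝ (fderiv ℝ (fun a' => G (a', b))) a u w =
      fderiv ℝ (fun q => fderiv ℝ G q (w, 0)) (a, b) (u, 0) := by
  have c := contDiffAt_slice hG
  rw [← fderiv_fderiv_apply c]
  have h : (fun a' => fderiv ℝ (fun a'' => G (a'', b)) a' w) =ᶠ[𝓝 a]
      fun a' => fderiv ℝ G (a', b) (w, 0) := by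
    have : ContinuousAt (fun a' : E => (a', b)) a := by fun_prop
    filter_upwards [this.eventually (hG.eventually (by simp))] with a' ha'
    exact fderiv_slice (ha'.differentiableAt (by simp)) w
  rw [h.fderiv_eq]
  exact fderiv_slice (G := fun q => fderiv ℝ G q (w, 0))
    ((ContDiffAt.fderiv_apply_const hG (m := 1) (by norm_num) _).differentiableAt (by simp)) u

/-- If `∂∂̄` of a smooth function does not depend on a parameter, then its derivative with respect
to the parameter is pluriharmonic. -/
theorem pluriharmonicAt_fderiv_parameter {G : E × T → ℝ} {a : E} {b₀ : T}
    (hG : ContDiffAt ℝ 3 G (a, b₀))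
    (h : ∀ᶠ b in 𝓝 b₀, PluriharmonicAt (fun a' => G (a', b) - G (a', b₀)) a) (v : T) :
    PluriharmonicAt (fun a' => fderiv ℝ G (a', b₀) (0, v)) a := by
  intro u w
  let D : E → E → E × T → ℝ := fun u w q => fderiv ℝ (fun q => fderiv ℝ G q (w, 0)) q (u, 0)
  have cD : ∀ u w, ContDiffAt ℝ 1 (D u w) (a, b₀) := fun u w =>
    ContDiffAt.fderiv_apply_const
      (ContDiffAt.fderiv_apply_const hG (m := 2) (by norm_num) _) (by norm_num) _
  have h2 := hG.of_le (show (2 : ℕ∞ω) ≤ 3 by norm_num)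
  have cV : ContDiffAt ℝ 2 (fun q => fderiv ℝ G q (0, v)) (a, b₀) :=
    ContDiffAt.fderiv_apply_const hG (by norm_num) _
  -- Make the derivative along `v` the outermost one, so that it acts on the Hessian expressions `D`
  -- in the `E`-directions.
  rw [fderiv_fderiv_slice cV, fderiv_fderiv_slice cV,
    ← fderiv_fderiv_fderiv_comm hG (Complex.I • u, 0) (0, v) (w, 0),
    ← fderiv_fderiv_fderiv_comm hG (u, 0) (0, v) (Complex.I • w, 0)]
  have hc : ContinuousAt (fun b : T => (a, b)) b₀ := by fun_prop
  -- `D (iu) w - D u (iw)` is the obstruction to pluriharmonicity in the `E`-directions. By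
  -- hypothesis it does not change with `b` near `b₀`, so its derivative along `v` vanishes.
  have key : (fun b => D (Complex.I • u) w (a, b) - D u (Complex.I • w) (a, b)) =ᶠ[𝓝 b₀]
      fun _ => D (Complex.I • u) w (a, b₀) - D u (Complex.I • w) (a, b₀) := by
    filter_upwards [h, hc.eventually (h2.eventually (by simp))] with b hb hb2
    have e : ∀ u w, fderiv ℝ (fderiv ℝ (fun a' => G (a', b) - G (a', b₀))) a u w =
        D u w (a, b) - D u w (a, b₀) := by
      intro u w
      have c1 := contDiffAt_slice hb2
      have c2 := contDiffAt_slice h2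
      have e1 : fderiv ℝ (fun a' => G (a', b) - G (a', b₀)) =ᶠ[𝓝 a]
          fun a' => fderiv ℝ (fun a' => G (a', b)) a' - fderiv ℝ (fun a' => G (a', b₀)) a' := by
        filter_upwards [c1.eventually (by simp), c2.eventually (by simp)] with a' k1 k2
        exact fderiv_sub (k1.differentiableAt (by simp)) (k2.differentiableAt (by simp))
      rw [e1.fderiv_eq, fderiv_fun_sub
        ((c1.fderiv_right (m := 1) (by norm_num)).differentiableAt (by simp))
        ((c2.fderiv_right (m := 1) (by norm_num)).differentiableAt (by simp))]
      simp only [sub_apply]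
      rw [fderiv_fderiv_slice hb2, fderiv_fderiv_slice h2]
    have := hb u w
    rw [e, e] at this
    linarith
  have d : ∀ u w, HasFDerivAt (fun b => D u w (a, b))
      ((fderiv ℝ (D u w) (a, b₀)).comp (ContinuousLinearMap.inr ℝ E T)) b₀ := fun u w =>
    ((cD u w).differentiableAt (by simp)).hasFDerivAt.comp b₀ (hasFDerivAt_prodMk_right a b₀)
  have h3 := ((d (Complex.I • u) w).sub (d u (Complex.I • w))).unique
    ((hasFDerivAt_const _ b₀).congr_of_eventuallyEq key)
  have h4 := congrArg (fun l : T →L[ℝ] ℝ => l v) h3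
  simpa [sub_eq_zero, D] using h4

end Parameters

/-! ### The derivative of the determinant at the identity -/

section Det

variable {r : ℕ}

theorem contDiff_det {n : ℕ∞ω} :
    ContDiff ℂ n (fun A : (Fin r → ℂ) →L[ℂ] (Fin r → ℂ) => LinearMap.det A.toLinearMap) := by
  have h : ∀ i j, ContDiff ℂ n (fun A : (Fin r → ℂ) →L[ℂ] (Fin r → ℂ) => A (Pi.single j 1) i) :=
    fun i j => contDiff_pi.1 (contDiff_id.clm_apply contDiff_const) i
  have e : (fun A : (Fin r → ℂ) →L[ℂ] (Fin r → ℂ) => LinearMap.det A.toLinearMap) = fun A =>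
      ∑ σ : Equiv.Perm (Fin r), ((Equiv.Perm.sign σ : ℤ) : ℂ) *
        ∏ i, A (Pi.single i 1) (σ i) := by
    ext A
    rw [← LinearMap.det_toMatrix', Matrix.det_apply']
    simp [LinearMap.toMatrix'_apply]
  rw [e]
  exact ContDiff.sum fun σ _ => contDiff_const.mul (contDiff_prod fun i _ => h _ _)

/-- Restrict to the line `s ↦ 1 + s B`, where `det (1 + s B) = 1 + s tr B + s² p(s)` with `p` a
polynomial, and read off the linear coefficient. -/
theorem fderiv_det_one (B : (Fin r → ℂ) →L[ℂ] (Fin r → ℂ)) :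
    fderiv ℂ (fun A : (Fin r → ℂ) →L[ℂ] (Fin r → ℂ) => LinearMap.det A.toLinearMap) 1 B =
      LinearMap.trace ℂ _ B.toLinearMap := by
  set d := fun A : (Fin r → ℂ) →L[ℂ] (Fin r → ℂ) => LinearMap.det A.toLinearMap
  have h1 : HasFDerivAt d (fderiv ℂ d 1) (1 + (0 : ℂ) • B) := by
    have e : (1 : (Fin r → ℂ) →L[ℂ] (Fin r → ℂ)) + (0 : ℂ) • B = 1 := by ext; simp
    rw [e]
    exact (contDiff_det.differentiable one_ne_zero).differentiableAt.hasFDerivAt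
  have h2 : HasDerivAt (fun s : ℂ => 1 + s • B) B 0 := by
    simpa using ((hasDerivAt_id (0 : ℂ)).smul_const B).const_add 1
  have h3 := h1.comp_hasDerivAt 0 h2
  let M := LinearMap.toMatrix' B.toLinearMap
  let p := (Matrix.det (1 + (Polynomial.X : Polynomial ℂ) • M.map Polynomial.C)).divX.divX
  have e : d ∘ (fun s : ℂ => 1 + s • B) =
      fun s => 1 + M.trace * s + p.eval s * s ^ 2 := by
    ext s
    change LinearMap.det (LinearMap.id + s • B.toLinearMap) = _
    rw [← LinearMap.det_toMatrix', map_add, map_smul, LinearMap.toMatrix'_id,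
      Matrix.det_one_add_smul]
  rw [e] at h3
  have h4 : HasDerivAt (fun s : ℂ => 1 + M.trace * s + p.eval s * s ^ 2) M.trace 0 := by
    have := (((hasDerivAt_id (0 : ℂ)).const_mul M.trace).const_add 1).add
      ((p.hasDerivAt 0).mul (hasDerivAt_pow 2 (0 : ℂ)))
    exact this.congr_deriv (by simp)
  rw [h3.unique h4]
  exact (LinearMap.trace_eq_matrix_trace ℂ (Pi.basisFun ℂ (Fin r)) _).symm

end Det

/-! ### Gram determinants -/

section Gram

variable {r : ℕ} {W : Type*} [AddCommGroup W] [Module ℂ W]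

/-- The Gram determinant of the images of the standard basis vectors under `L`. -/
noncomputable def gramDet (B : W →ₗ⋆[ℂ] W →ₗ[ℂ] ℂ) (L : (Fin r → ℂ) →ₗ[ℂ] W) : ℂ :=
  Matrix.det (Matrix.of fun j k : Fin r => B (L (Pi.single j 1)) (L (Pi.single k 1)))

/-- The Gram matrix `G` becomes `N* G N`; the adjoint is on the left because the form is conjugate
linear in its first argument. -/
theorem gramDet_comp (B : W →ₗ⋆[ℂ] W →ₗ[ℂ] ℂ) (L : (Fin r → ℂ) →ₗ[ℂ] W)
    (N : Module.End ℂ (Fin r → ℂ)) :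
    gramDet B (L ∘ₗ N) = Complex.normSq (LinearMap.det N) * gramDet B L := by
  have hN : ∀ j, N (Pi.single j 1) =
      ∑ a, LinearMap.toMatrix' N a j • (Pi.single a 1 : Fin r → ℂ) := by
    intro j
    simp only [LinearMap.toMatrix'_apply]
    exact (pi_eq_sum_univ' _)
  have h : (Matrix.of fun j k : Fin r => B ((L ∘ₗ N) (Pi.single j 1)) ((L ∘ₗ N) (Pi.single k 1))) =
      (LinearMap.toMatrix' N).conjTranspose *
        (Matrix.of fun j k : Fin r => B (L (Pi.single j 1)) (L (Pi.single k 1))) *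
        LinearMap.toMatrix' N := by
    ext j k
    simp only [Matrix.of_apply, LinearMap.comp_apply, Matrix.mul_apply, hN, map_sum, map_smul,
      LinearMap.sum_apply, map_smulₛₗ, LinearMap.smul_apply, smul_eq_mul, Finset.sum_mul,
      Matrix.conjTranspose_apply, Complex.star_def, Finset.mul_sum]
    exact Finset.sum_congr rfl fun a _ => Finset.sum_congr rfl fun b _ => by ring
  rw [gramDet, h, Matrix.det_mul, Matrix.det_mul, Matrix.det_conjTranspose,
    LinearMap.det_toMatrix', gramDet, ← Complex.mul_conj, Complex.star_def]
  ring

open scoped ComplexOrder in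
-- The Gram matrix is positive definite because `x* G x = B (L x) (L x)`. Positivity of the real
-- part is what makes its logarithm smooth and additive under a change of frame.
theorem gramDet_re_pos {B : W →ₗ⋆[ℂ] W →ₗ[ℂ] ℂ} (hB : ∀ v w, conj (B v w) = B w v)
    (hpos : ∀ v, v ≠ 0 → 0 < (B v v).re) {L : (Fin r → ℂ) →ₗ[ℂ] W} (hL : Function.Injective L) :
    0 < (gramDet B L).re := by
  have h : (Matrix.of fun j k : Fin r => B (L (Pi.single j 1)) (L (Pi.single k 1))).PosDef := by
    refine Matrix.PosDef.of_dotProduct_mulVec_pos ?_ fun x hx => ?_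
    · ext j k
      simp [Matrix.conjTranspose_apply, hB]
    · have e : L x = ∑ j, x j • L (Pi.single j 1) := by
        conv_lhs => rw [pi_eq_sum_univ' x]
        simp
      have e2 : star x ⬝ᵥ Matrix.mulVec
          (Matrix.of fun j k : Fin r => B (L (Pi.single j 1)) (L (Pi.single k 1))) x =
          B (L x) (L x) := by
        rw [e]
        simp only [dotProduct, Matrix.mulVec, Matrix.of_apply, map_sum, map_smul,
          LinearMap.sum_apply, map_smulₛₗ, LinearMap.smul_apply, smul_eq_mul, Finset.mul_sum,
          Pi.star_apply, Complex.star_def]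
        refine Finset.sum_comm.trans ?_
        exact Finset.sum_congr rfl fun a _ => Finset.sum_congr rfl fun b _ => by ring
      rw [e2, Complex.lt_def]
      refine ⟨hpos _ fun h0 => hx (hL (by simpa using h0)), ?_⟩
      exact (Complex.conj_eq_iff_im.1 (hB _ _)).symm
  exact (Complex.lt_def.1 h.det_pos).1

theorem log_gramDet_comp {B : W →ₗ⋆[ℂ] W →ₗ[ℂ] ℂ} (hB : ∀ v w, conj (B v w) = B w v)
    (hpos : ∀ v, v ≠ 0 → 0 < (B v v).re) {L : (Fin r → ℂ) →ₗ[ℂ] W} (hL : Function.Injective L)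
    {N : Module.End ℂ (Fin r → ℂ)} (hN : LinearMap.det N ≠ 0) :
    Real.log (gramDet B (L ∘ₗ N)).re =
      Real.log (Complex.normSq (LinearMap.det N)) + Real.log (gramDet B L).re := by
  rw [gramDet_comp, Complex.re_ofReal_mul, Real.log_mul (by simpa using hN)
    (gramDet_re_pos hB hpos hL).ne']

end Gram

/-! ### Charts -/

section Charts

variable {𝕜 : Type*} [NontriviallyNormedField 𝕜]
  {E : Type*} [NormedAddCommGroup E] [NormedSpace 𝕜 E]
  {T : Type*} [NormedAddCommGroup T] [NormedSpace 𝕜 T]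
  {A : Type*} [NormedAddCommGroup A] [NormedSpace 𝕜 A]
  {X : Type*} [TopologicalSpace X] [ChartedSpace E X]
  {S : Type*} [TopologicalSpace S] [ChartedSpace T S]

theorem ContMDiffAt.contDiffAt_chart_prod {f : X × S → A} {x : X} {s : S} {n : ℕ∞ω}
    (hf : ContMDiffAt (𝓘(𝕜, E).prod 𝓘(𝕜, T)) 𝓘(𝕜, A) n f (x, s)) :
    ContDiffAt 𝕜 n (fun q : E × T => f ((chartAt E x).symm q.1, (chartAt T s).symm q.2))
      (chartAt E x x, chartAt T s s) := by
  have h := (contMDiffAt_iff.1 hf).2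
  rw [extChartAt_prod] at h
  simp only [ModelWithCorners.range_eq_univ, contDiffWithinAt_univ] at h
  exact h

theorem MDifferentiableAt.differentiableAt_chart [IsManifold 𝓘(𝕜, E) 1 X] {f : X → A} {x z : X}
    (hz : z ∈ (chartAt E x).source) (hf : MDifferentiableAt 𝓘(𝕜, E) 𝓘(𝕜, A) f z) :
    DifferentiableAt 𝕜 (fun a => f ((chartAt E x).symm a)) (chartAt E x z) := by
  have h := mdifferentiableAt_symm_of_mem_maximalAtlas (I := 𝓘(𝕜, E))
    (IsManifold.chart_mem_maximalAtlas (I := 𝓘(𝕜, E)) (n := 1) x)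
    ((chartAt E x).map_source hz)
  rw [← (chartAt E x).left_inv hz] at hf
  exact (MDifferentiableAt.comp _ hf h).differentiableAt

theorem DifferentiableAt.mdifferentiableAt_chart [IsManifold 𝓘(𝕜, E) 1 X] {f : E → A} {x z : X}
    (hz : z ∈ (chartAt E x).source) (hf : DifferentiableAt 𝕜 f (chartAt E x z)) :
    MDifferentiableAt 𝓘(𝕜, E) 𝓘(𝕜, A) (fun z => f (chartAt E x z)) z :=
  hf.mdifferentiableAt.comp z (mdifferentiableAt_of_mem_maximalAtlas (I := 𝓘(𝕜, E))
    (IsManifold.chart_mem_maximalAtlas (I := 𝓘(𝕜, E)) (n := 1) x) hz)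

theorem ContMDiffAt.contDiffAt_chart {n : ℕ∞ω} [IsManifold 𝓘(𝕜, E) n X] {f : X → A} {x z : X}
    (hz : z ∈ (chartAt E x).source) (hf : ContMDiffAt 𝓘(𝕜, E) 𝓘(𝕜, A) n f z) :
    ContDiffAt 𝕜 n (fun a => f ((chartAt E x).symm a)) (chartAt E x z) := by
  have h := contMDiffAt_symm_of_mem_maximalAtlas (I := 𝓘(𝕜, E)) (n := n)
    (IsManifold.chart_mem_maximalAtlas (I := 𝓘(𝕜, E)) (n := n) x)
    ((chartAt E x).map_source hz)
  rw [← (chartAt E x).left_inv hz] at hf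
  exact (ContMDiffAt.comp _ hf h).contDiffAt

theorem contDiffAt_chart_transition {n : ℕ∞ω} [IsManifold 𝓘(𝕜, E) n X] {x z : X}
    (hz : z ∈ (chartAt E x).source) :
    ContDiffAt 𝕜 n (fun a => chartAt E z ((chartAt E x).symm a)) (chartAt E x z) :=
  ContMDiffAt.contDiffAt_chart hz (contMDiffAt_of_mem_maximalAtlas (I := 𝓘(𝕜, E))
    (IsManifold.chart_mem_maximalAtlas (I := 𝓘(𝕜, E)) (n := n) z) (mem_chart_source E z))

end Charts

/-! ### Holomorphic functions on manifolds and a criterion for real classes -/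

section

variable {E : Type*} [NormedAddCommGroup E] [NormedSpace ℂ E]
  {T : Type*} [NormedAddCommGroup T] [NormedSpace ℂ T]
  {A : Type*} [NormedAddCommGroup A] [NormedSpace ℂ A]
  {X : Type*} [TopologicalSpace X] [ChartedSpace E X]
  {S : Type*} [TopologicalSpace S] [ChartedSpace T S]

theorem dirDeriv_eq_fderiv {o : S} (v : TangentSpace 𝓘(ℂ, T) o) {f : S → A}
    (hf : MDifferentiableAt 𝓘(ℂ, T) 𝓘(ℂ, A) f o) :
    dirDeriv v f = fderiv ℂ (fun b => f ((chartAt T o).symm b)) (chartAt T o o) v := by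
  have h := hf.mfderiv
  simp only [ModelWithCorners.range_eq_univ, fderivWithin_univ] at h
  exact congrArg (fun D : T →L[ℂ] A => D v) h

theorem differentiableAt_chart_self {o : S} {f : S → A}
    (hf : MDifferentiableAt 𝓘(ℂ, T) 𝓘(ℂ, A) f o) :
    DifferentiableAt ℂ (fun b => f ((chartAt T o).symm b)) (chartAt T o o) := by
  have h := ((mdifferentiableAt_iff _ _).1 hf).2
  simp only [ModelWithCorners.range_eq_univ, differentiableWithinAt_univ] at h
  exact h

/-- A holomorphic function on a complex manifold with vanishing real part is locally constant. -/
theorem eventually_eq_of_mdifferentiableAt_of_re_eq_zero [IsManifold 𝓘(ℂ, E) ω X] {f : X → ℂ}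
    {z : X} (h : ∀ᶠ y in 𝓝 z, MDifferentiableAt 𝓘(ℂ, E) 𝓘(ℂ, ℂ) f y ∧ (f y).re = 0) :
    ∀ᶠ y in 𝓝 z, f y = f z := by
  have : IsManifold 𝓘(ℂ, E) 1 X := .of_le (n := ω) (by simp)
  have hz := mem_chart_source E z
  have h1 : ∀ᶠ a in 𝓝 (chartAt E z z), DifferentiableAt ℂ (fun a => f ((chartAt E z).symm a)) a ∧
      (f ((chartAt E z).symm a)).re = 0 := by
    have hc : Filter.Tendsto (chartAt E z).symm (𝓝 (chartAt E z z)) (𝓝 z) :=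
      (chartAt E z).tendsto_symm hz
    filter_upwards [hc.eventually h, (chartAt E z).open_target.mem_nhds
      ((chartAt E z).map_source hz)] with a ha ht
    refine ⟨?_, ha.2⟩
    have := MDifferentiableAt.differentiableAt_chart ((chartAt E z).map_target ht) ha.1
    rwa [(chartAt E z).right_inv ht] at this
  filter_upwards [((chartAt E z).continuousAt hz).eventually (eventually_eq_of_re_eq_zero h1),
    (chartAt E z).open_source.mem_nhds hz] with y hy hs
  rwa [(chartAt E z).left_inv hs, (chartAt E z).left_inv hz] at hy

/-- If the real part of a holomorphic cocycle is the coboundary of the real parts of holomorphic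
functions, then its class divided by `2πi` comes from `H¹(X, ℝ)`. -/
theorem smul_mk_mem_range_iStar [IsManifold 𝓘(ℂ, E) ω X] (τ : (structureSheaf E X).cocycles)
    (W : ∀ x : X, OpenNhdsOf x) (q : X → X → ℂ)
    (hq : ∀ x z, z ∈ W x → MDifferentiableAt 𝓘(ℂ, E) 𝓘(ℂ, ℂ) (q x) z)
    (hre : ∀ x y z, z ∈ W x → z ∈ W y → (τ.1 x y z).re = (q y z - q x z).re) :
    (1 / (2 * (Real.pi : ℂ) * Complex.I)) • SectionSheaf.H1.mk _ τ ∈ Set.range (iStar E X) := by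
  obtain ⟨U, hU, hU'⟩ := τ.2
  -- The real cocycle that will represent the class: `τ - δq` is purely imaginary, so its quotient
  -- by `2πi` is its imaginary part over `2π`.
  let c : X → X → X → ℝ := fun x y z => (τ.1 x y z - (q y z - q x z)).im / (2 * Real.pi)
  have hτ : ∀ x y z, z ∈ W x → z ∈ W y →
      τ.1 x y z - (q y z - q x z) = Complex.I * (2 * Real.pi * c x y z) := by
    intro x y z hx hy
    have hπ := Real.pi_ne_zero
    have hc : 2 * Real.pi * c x y z = (τ.1 x y z - (q y z - q x z)).im := by
      simp only [c]
      field_simp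
    have hc' : (2 * Real.pi * c x y z : ℂ) = ((2 * Real.pi * c x y z : ℝ) : ℂ) := by push_cast; rfl
    rw [hc', hc]
    apply Complex.ext
    · rw [Complex.sub_re, hre x y z hx hy]; simp
    · simp
  have hc : c ∈ (constSheaf X).cocycles := by
    refine ⟨fun x => U x ⊓ W x, fun x y z hx hy => ?_, fun x y w z hx hy hw => ?_⟩
    · have : ∀ᶠ p in 𝓝 z, τ.1 x y p - (q y p - q x p) = τ.1 x y z - (q y z - q x z) := by
        refine eventually_eq_of_mdifferentiableAt_of_re_eq_zero (E := E)
          (f := fun p => τ.1 x y p - (q y p - q x p)) ?_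
        filter_upwards [(U x ⊓ W x).isOpen.mem_nhds hx, (U y ⊓ W y).isOpen.mem_nhds hy] with p h1 h2
        refine ⟨(hU x y p h1.1 h2.1).sub ((hq y p h2.2).sub (hq x p h1.2)), ?_⟩
        rw [Complex.sub_re, hre x y p h1.2 h2.2, sub_self]
      filter_upwards [this] with p hp
      simp only [c, hp]
    · have := hU' x y w z hx.1 hy.1 hw.1
      simp only [c, ← this, Complex.sub_im, Complex.add_im]
      ring
  refine ⟨SectionSheaf.H1.mk _ ⟨c, hc⟩, ?_⟩
  have hne : (2 * (Real.pi : ℂ) * Complex.I) ≠ 0 := by simp [Real.pi_ne_zero]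
  refine (Submodule.Quotient.eq _).2 ?_
  -- `c - τ / (2πi)` is the coboundary of `-q / (2πi)`.
  refine ⟨W, fun x => (-(1 / (2 * (Real.pi : ℂ) * Complex.I))) • q x, fun x z hz =>
    ((structureSheaf E X).at' z).smul_mem _ (hq x z hz), fun x y z hx hy => ?_⟩
  change ((c x y z : ℝ) : ℂ) - (1 / (2 * (Real.pi : ℂ) * Complex.I)) * τ.1 x y z =
    -(1 / (2 * (Real.pi : ℂ) * Complex.I)) * q y z - -(1 / (2 * (Real.pi : ℂ) * Complex.I)) * q x z
  have h := hτ x y z hx hy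
  rw [sub_eq_iff_eq_add] at h
  rw [h]
  field_simp
  ring

end

/-! ### Changes of holomorphic frame -/

section Deformation

variable {E : Type*} [NormedAddCommGroup E] [NormedSpace ℂ E]
  {T : Type*} [NormedAddCommGroup T] [NormedSpace ℂ T]
  {X : Type*} [TopologicalSpace X] [ChartedSpace E X]
  {S : Type*} [TopologicalSpace S] [ChartedSpace T S]
  {r : ℕ}
  {𝓔 : X × S → Type*} [∀ p, AddCommGroup (𝓔 p)] [∀ p, Module ℂ (𝓔 p)]
  [TopologicalSpace (TotalSpace (Fin r → ℂ) 𝓔)] [∀ p, TopologicalSpace (𝓔 p)]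
  [FiberBundle (Fin r → ℂ) 𝓔] [VectorBundle ℂ (Fin r → ℂ) 𝓔]

variable (r 𝓔) in
/-- The determinant of the change of frame from the preferred trivialization around `p₁` to the one
around `p₀`. -/
noncomputable def changeDet (p₀ p₁ p : X × S) : ℂ :=
  LinearMap.det (coords r 𝓔 p₀ p ∘ₗ frame r 𝓔 p₁ p)

theorem frame_injective {p₀ p : X × S}
    (hp : p ∈ (trivializationAt (Fin r → ℂ) 𝓔 p₀).baseSet) :
    Function.Injective (frame r 𝓔 p₀ p) :=
  (coordsEquiv r 𝓔 hp).symm.injective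

theorem det_coords_comp_ne_zero {p₀ p₁ p q : X × S}
    (hp : p ∈ (trivializationAt (Fin r → ℂ) 𝓔 p₀).baseSet)
    (hq : q ∈ (trivializationAt (Fin r → ℂ) 𝓔 p₁).baseSet) (φ : 𝓔 q ≃ₗ[ℂ] 𝓔 p) :
    LinearMap.det (coords r 𝓔 p₀ p ∘ₗ φ.toLinearMap ∘ₗ frame r 𝓔 p₁ q) ≠ 0 :=
  (LinearEquiv.isUnit_det'
    (((coordsEquiv r 𝓔 hq).symm.trans φ).trans (coordsEquiv r 𝓔 hp))).ne_zero

theorem changeDet_ne_zero {p₀ p₁ p : X × S}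
    (h₀ : p ∈ (trivializationAt (Fin r → ℂ) 𝓔 p₀).baseSet)
    (h₁ : p ∈ (trivializationAt (Fin r → ℂ) 𝓔 p₁).baseSet) : changeDet r 𝓔 p₀ p₁ p ≠ 0 :=
  det_coords_comp_ne_zero h₀ h₁ (LinearEquiv.refl ℂ _)

theorem changeDet_contMDiffAt
    [ContMDiffVectorBundle ω (Fin r → ℂ) 𝓔 (𝓘(ℂ, E).prod 𝓘(ℂ, T))] {p₀ p₁ p : X × S}
    (h₀ : p ∈ (trivializationAt (Fin r → ℂ) 𝓔 p₀).baseSet)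
    (h₁ : p ∈ (trivializationAt (Fin r → ℂ) 𝓔 p₁).baseSet) :
    ContMDiffAt (𝓘(ℂ, E).prod 𝓘(ℂ, T)) 𝓘(ℂ, ℂ) ω (changeDet r 𝓔 p₀ p₁) p := by
  let e₀ := trivializationAt (Fin r → ℂ) 𝓔 p₀
  let e₁ := trivializationAt (Fin r → ℂ) 𝓔 p₁
  have c := contMDiffAt_coordChangeL (n := ω) (IB := 𝓘(ℂ, E).prod 𝓘(ℂ, T))
    (e := e₁) (e' := e₀) h₁ h₀
  refine (contDiff_det.contMDiff.contMDiffAt.comp p c).congr_of_eventuallyEq ?_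
  filter_upwards [e₀.open_baseSet.mem_nhds h₀, e₁.open_baseSet.mem_nhds h₁] with q k₀ k₁
  simp only [changeDet, Function.comp_apply]
  congr 1
  ext1 u
  ext1
  simp only [LinearMap.comp_apply, ContinuousLinearMap.coe_coe, ContinuousLinearEquiv.coe_coe]
  rw [Trivialization.coordChangeL_apply _ _ ⟨k₁, k₀⟩, coords,
    e₀.coe_linearMapAt_of_mem (R := ℂ) k₀, frame, e₁.symmₗ_apply (R := ℂ) k₁]

/-! ### The function `log det g` and Ricci-flatness -/

namespace HermitianMetric

variable (g : HermitianMetric E T r 𝓔)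

theorem logDet_eq (p₀ p : X × S) :
    g.logDet p₀ p = Real.log (gramDet (g.form p) (frame r 𝓔 p₀ p)).re := rfl

theorem logDet_change {p₀ p₁ p : X × S}
    (h₀ : p ∈ (trivializationAt (Fin r → ℂ) 𝓔 p₀).baseSet)
    (h₁ : p ∈ (trivializationAt (Fin r → ℂ) 𝓔 p₁).baseSet) :
    g.logDet p₀ p = g.logDet p₁ p - Real.log (Complex.normSq (changeDet r 𝓔 p₀ p₁ p)) := by
  have h : frame r 𝓔 p₁ p = frame r 𝓔 p₀ p ∘ₗ (coords r 𝓔 p₀ p ∘ₗ frame r 𝓔 p₁ p) := by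
    ext1 u
    ext1
    simp [frame_coords r 𝓔 h₀]
  rw [g.logDet_eq p₁, h, log_gramDet_comp (g.conj_symm p) (g.pos p) (frame_injective h₀)
    (changeDet_ne_zero h₀ h₁), g.logDet_eq p₀, changeDet]
  ring

theorem contDiffAt_logDet (x : X) (s : S) :
    ContDiffAt ℝ ∞ (fun q : E × T =>
      g.logDet (x, s) ((chartAt E x).symm q.1, (chartAt T s).symm q.2))
      (chartAt E x x, chartAt T s s) := by
  have hx := (chartAt E x).left_inv (mem_chart_source E x)
  have hs := (chartAt T s).left_inv (mem_chart_source T s)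
  have hG : ContDiffAt ℝ ∞ (fun q : E × T =>
      (gramDet (g.form ((chartAt E x).symm q.1, (chartAt T s).symm q.2))
        (frame r 𝓔 (x, s) ((chartAt E x).symm q.1, (chartAt T s).symm q.2))).re)
      (chartAt E x x, chartAt T s s) := by
    refine Complex.reCLM.contDiff.contDiffAt.comp _ ?_
    have h : ∀ j k, ContDiffAt ℝ ∞ (fun q : E × T =>
        g.form ((chartAt E x).symm q.1, (chartAt T s).symm q.2)
          (frame r 𝓔 (x, s) ((chartAt E x).symm q.1, (chartAt T s).symm q.2) (Pi.single j 1))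
          (frame r 𝓔 (x, s) ((chartAt E x).symm q.1, (chartAt T s).symm q.2) (Pi.single k 1)))
        (chartAt E x x, chartAt T s s) := fun j k =>
      ContMDiffAt.contDiffAt_chart_prod (g.smooth (x, s) (Pi.single j 1) (Pi.single k 1))
    simp only [gramDet, Matrix.det_apply', Matrix.of_apply]
    exact ContDiffAt.sum fun σ _ => contDiffAt_const.mul (contDiffAt_prod fun i _ => h _ _)
  refine hG.log (gramDet_re_pos (g.conj_symm _) (g.pos _) (frame_injective ?_)).ne'
  simpa only [hx, hs] using mem_base r 𝓔 (x, s)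

theorem contDiffAt_logDet_slice (x : X) (s : S) :
    ContDiffAt ℝ ∞ (fun a => g.logDet (x, s) ((chartAt E x).symm a, s)) (chartAt E x x) := by
  have h := contDiffAt_slice (g.contDiffAt_logDet x s)
  simpa only [(chartAt T s).left_inv (mem_chart_source T s)] using h

variable [IsManifold 𝓘(ℂ, E) ω X]
  [ContMDiffVectorBundle ω (Fin r → ℂ) 𝓔 (𝓘(ℂ, E).prod 𝓘(ℂ, T))]

/-- `ricciForm` at `z` uses the frame and the chart centred at `z`. Comparing nearby points requires
one fixed frame and chart; the price is a term `log |d|²` with `d` holomorphic and nonvanishing,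
which is pluriharmonic. -/
theorem logDet_change_chart {x z : X} {t : S} {p₀ : X × S} (hz : z ∈ (chartAt E x).source)
    (h₀ : (z, t) ∈ (trivializationAt (Fin r → ℂ) 𝓔 p₀).baseSet) :
    ∃ d : E → ℂ, ContDiffAt ℂ ω d (chartAt E x z) ∧ d (chartAt E x z) ≠ 0 ∧
      (fun a => g.logDet p₀ ((chartAt E x).symm a, t)) =ᶠ[𝓝 (chartAt E x z)] fun a =>
        g.logDet (z, t) ((chartAt E z).symm (chartAt E z ((chartAt E x).symm a)), t) -
          Real.log (Complex.normSq (d a)) := by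
  have h₁ := mem_base r 𝓔 (z, t)
  have hx := (chartAt E x).left_inv hz
  refine ⟨fun a => changeDet r 𝓔 p₀ (z, t) ((chartAt E x).symm a, t), ?_, ?_, ?_⟩
  · exact ContMDiffAt.contDiffAt_chart (f := fun y => changeDet r 𝓔 p₀ (z, t) (y, t)) hz
      (ContMDiffAt.comp z (I' := 𝓘(ℂ, E).prod 𝓘(ℂ, T)) (g := changeDet r 𝓔 p₀ (z, t))
        (f := fun y => (y, t))
        (changeDet_contMDiffAt h₀ h₁) (contMDiffAt_id.prodMk contMDiffAt_const))
  · simp only [hx]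
    exact changeDet_ne_zero h₀ h₁
  · have hc : Filter.Tendsto (chartAt E x).symm (𝓝 (chartAt E x z)) (𝓝 z) :=
      (chartAt E x).tendsto_symm hz
    have hp : ContinuousAt (fun y : X => (y, t)) z := (Continuous.prodMk_left t).continuousAt
    filter_upwards [hc.eventually ((chartAt E z).open_source.mem_nhds (mem_chart_source E z)),
      hc.eventually (hp.eventually ((Trivialization.open_baseSet _).mem_nhds h₀)),
      hc.eventually (hp.eventually ((Trivialization.open_baseSet _).mem_nhds h₁))] with a k₁ k₂ k₃
    rw [(chartAt E z).left_inv k₁]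
    exact g.logDet_change k₂ k₃

/-- Ricci-flatness, expressed in arbitrary frames and in arbitrary charts. -/
theorem IsRicciFlat.pluriharmonicAt {g : HermitianMetric E T r 𝓔} {o : S} (hg : g.IsRicciFlat o)
    {x z : X} {t : S} {p₀ : X × S} (hz : z ∈ (chartAt E x).source)
    (ht : (z, t) ∈ (trivializationAt (Fin r → ℂ) 𝓔 p₀).baseSet)
    (ho : (z, o) ∈ (trivializationAt (Fin r → ℂ) 𝓔 p₀).baseSet) :
    PluriharmonicAt (fun a => g.logDet p₀ ((chartAt E x).symm a, t) -
      g.logDet p₀ ((chartAt E x).symm a, o)) (chartAt E x z) := by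
  obtain ⟨d₁, c₁, n₁, e₁⟩ := g.logDet_change_chart hz ht
  obtain ⟨d₂, c₂, n₂, e₂⟩ := g.logDet_change_chart hz ho
  have s₁ := (g.contDiffAt_logDet_slice z t).of_le (show (2 : ℕ∞ω) ≤ ∞ by norm_cast)
  have s₂ := (g.contDiffAt_logDet_slice z o).of_le (show (2 : ℕ∞ω) ≤ ∞ by norm_cast)
  have key := pluriharmonicAt_sub_of_ddbar_eq s₁ s₂ (hg t z)
  have hx := (chartAt E x).left_inv hz
  let h := fun a => chartAt E z ((chartAt E x).symm a)
  have hh : h (chartAt E x z) = chartAt E z z := by simp only [h, hx]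
  have ch : ContDiffAt ℂ 2 h (chartAt E x z) :=
    (contDiffAt_chart_transition (n := ω) hz).of_le (by simp)
  rw [← hh] at key s₁ s₂
  have c₁' := c₁.of_le (show (2 : ℕ∞ω) ≤ ω by simp)
  have c₂' := c₂.of_le (show (2 : ℕ∞ω) ≤ ω by simp)
  have L₁ := contDiffAt_log_normSq c₁' n₁
  have L₂ := contDiffAt_log_normSq c₂' n₂
  -- The curvature at `t` and at `o` is computed in the two different frames at `(z, t)` and `(z,
  -- o)`. Passing to the frame at `p₀` costs one pluriharmonic correction for each.
  have key₂ := (key.comp (s₁.sub s₂) ch).sub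
    ((pluriharmonicAt_log_normSq c₁' n₁).sub (pluriharmonicAt_log_normSq c₂' n₂) L₁ L₂)
    ((s₁.sub s₂).comp _ (ch.restrict_scalars ℝ)) (L₁.sub L₂)
  refine key₂.congr ?_
  filter_upwards [e₁, e₂] with a k₁ k₂
  rw [k₁, k₂]
  ring

/-- For a Ricci-flat deformation, the derivative of `log det g` in the direction of the parameter is
locally the real part of a holomorphic function. -/
theorem IsRicciFlat.exists_holomorphic {g : HermitianMetric E T r 𝓔} {o : S}
    (hg : g.IsRicciFlat o) (x : X) (v : T) :
    ∃ f : X → ℂ, ∀ᶠ z in 𝓝 x, MDifferentiableAt 𝓘(ℂ, E) 𝓘(ℂ, ℂ) f z ∧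
      DifferentiableAt ℝ (fun b => g.logDet (x, o) (z, (chartAt T o).symm b)) (chartAt T o o) ∧
      (f z).re = fderiv ℝ (fun b => g.logDet (x, o) (z, (chartAt T o).symm b))
        (chartAt T o o) v := by
  have : IsManifold 𝓘(ℂ, E) 1 X := .of_le (n := ω) (by simp)
  let G : E × T → ℝ := fun q =>
    g.logDet (x, o) ((chartAt E x).symm q.1, (chartAt T o).symm q.2)
  have hs := (chartAt T o).left_inv (mem_chart_source T o)
  -- Only a finite order of differentiability at a point spreads to a neighbourhood; three
  -- derivatives suffice, one in the parameter and two along `X`.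
  have hG : ∀ᶠ q in 𝓝 (chartAt E x x, chartAt T o o), ContDiffAt ℝ 3 G q :=
    ((g.contDiffAt_logDet x o).of_le (show (3 : ℕ∞ω) ≤ ∞ by norm_cast)).eventually (by simp)
  have hG' := (Continuous.prodMk_left (chartAt T o o)).continuousAt.eventually hG
  have hb : ∀ᶠ q in 𝓝 (chartAt E x x, chartAt T o o),
      ((chartAt E x).symm q.1, (chartAt T o).symm q.2) ∈
        (trivializationAt (Fin r → ℂ) 𝓔 (x, o)).baseSet := by
    have hc : Filter.Tendsto (fun q : E × T => ((chartAt E x).symm q.1, (chartAt T o).symm q.2))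
        (𝓝 (chartAt E x x, chartAt T o o)) (𝓝 (x, o)) := by
      rw [nhds_prod_eq, nhds_prod_eq]
      exact ((chartAt E x).tendsto_symm (mem_chart_source E x)).prodMap
        ((chartAt T o).tendsto_symm (mem_chart_source T o))
    exact hc.eventually ((Trivialization.open_baseSet _).mem_nhds (mem_base r 𝓔 (x, o)))
  have hφ : ∀ᶠ a in 𝓝 (chartAt E x x),
      ContDiffAt ℝ 2 (fun a => fderiv ℝ G (a, chartAt T o o) (0, v)) a ∧
      PluriharmonicAt (fun a => fderiv ℝ G (a, chartAt T o o) (0, v)) a := by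
    filter_upwards [hG', (Continuous.prodMk_left (chartAt T o o)).continuousAt.eventually
      (eventually_eventually_nhds.2 hb), (chartAt E x).open_target.mem_nhds
      ((chartAt E x).map_source (mem_chart_source E x))] with a ha hba hta
    refine ⟨contDiffAt_slice (ContDiffAt.fderiv_apply_const ha (by norm_num) _),
      pluriharmonicAt_fderiv_parameter ha ?_ v⟩
    filter_upwards [(Continuous.prodMk_right a).continuousAt.eventually hba] with b hbb
    have h1 := hba.self_of_nhds
    simp only [hs] at h1
    have := hg.pluriharmonicAt ((chartAt E x).map_target hta) hbb h1
    rw [(chartAt E x).right_inv hta] at this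
    simpa only [G, hs] using this
  obtain ⟨f, hf⟩ := exists_differentiable_re_eq hφ
  refine ⟨fun z => f (chartAt E x z), ?_⟩
  have hcx := (chartAt E x).continuousAt (mem_chart_source E x)
  filter_upwards [hcx.eventually hf, hcx.eventually hG',
    (chartAt E x).open_source.mem_nhds (mem_chart_source E x)] with z k₁ k₂ k₃
  have d : HasFDerivAt (fun b => G (chartAt E x z, b))
      ((fderiv ℝ G (chartAt E x z, chartAt T o o)).comp (ContinuousLinearMap.inr ℝ E T))
      (chartAt T o o) :=
    (k₂.differentiableAt (by simp)).hasFDerivAt.comp _ (hasFDerivAt_prodMk_right _ _)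
  simp only [G, (chartAt E x).left_inv k₃] at d
  refine ⟨DifferentiableAt.mdifferentiableAt_chart k₃ k₁.1, d.differentiableAt, ?_⟩
  rw [k₁.2, d.fderiv]
  simp [G]

end HermitianMetric

/-! ### Transported metrics and the trace of the infinitesimal class -/

namespace LocalTrivializations

variable {o : S} (Ψ : LocalTrivializations E T r 𝓔 o) (g : HermitianMetric E T r 𝓔)

/-- The trace of a continuous endomorphism of `ℂ^r`. -/
noncomputable def traceL (r : ℕ) : ((Fin r → ℂ) →L[ℂ] (Fin r → ℂ)) →L[ℂ] ℂ :=
  LinearMap.toContinuousLinearMap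
    (LinearMap.trace ℂ (Fin r → ℂ) ∘ₗ LinearMap.toContinuousLinearMap.symm.toLinearMap)

/-- `log det` of the metric that `g` induces on the fibre of `𝓔₀` at `z` via `ψ_x(z, t)`. -/
noncomputable def transportLogDet (x z : X) (t : S) : ℝ :=
  Real.log (gramDet (g.form (z, t))
    ((Ψ.ψ x z t).symm.toLinearMap ∘ₗ frame r 𝓔 (z, o) (z, o))).re

/-- The derivative of `transportLogDet` at `o` in the direction `v`. -/
noncomputable def transportDeriv (v : TangentSpace 𝓘(ℂ, T) o) (x z : X) : ℝ :=
  fderiv ℝ (fun b => Ψ.transportLogDet g x z ((chartAt T o).symm b)) (chartAt T o o) v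

/-- Relative to the frame around `(z₀, o)`, the transported Gram determinant is that of `g` times
`|det A|² / |det ψ_x|²`. The preferred frame at `z`, which may vary irregularly with `z`, enters
only through `A`, which is constant in `t` and disappears on differentiation. Since `ψ_x` is the
identity at `o`, the derivative of `log |det ψ_x|²` there is twice the real part of a trace. -/
theorem transportDeriv_eq (v : TangentSpace 𝓘(ℂ, T) o) {x z z₀ : X} (hx : z ∈ Ψ.U x)
    (hz : (z, o) ∈ (trivializationAt (Fin r → ℂ) 𝓔 (z₀, o)).baseSet)
    (dx : MDifferentiableAt 𝓘(ℂ, T) 𝓘(ℂ, (Fin r → ℂ) →L[ℂ] (Fin r → ℂ))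
      (fun t : S => Ψ.mat x z₀ (z, t)) o)
    (dg : DifferentiableAt ℝ (fun b => g.logDet (z₀, o) (z, (chartAt T o).symm b))
      (chartAt T o o)) :
    Ψ.transportDeriv g v x z =
      fderiv ℝ (fun b => g.logDet (z₀, o) (z, (chartAt T o).symm b)) (chartAt T o o) v -
        2 * (traceL r (dirDeriv v (fun t => Ψ.mat x z₀ (z, t)))).re := by
  have hs := (chartAt T o).left_inv (mem_chart_source T o)
  let A : Module.End ℂ (Fin r → ℂ) := coords r 𝓔 (z₀, o) (z, o) ∘ₗ frame r 𝓔 (z, o) (z, o)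
  let m : T → (Fin r → ℂ) →L[ℂ] (Fin r → ℂ) := fun b => Ψ.mat x z₀ (z, (chartAt T o).symm b)
  have hA : LinearMap.det A ≠ 0 := changeDet_ne_zero hz (mem_base r 𝓔 (z, o))
  have hone : m (chartAt T o o) = 1 := by
    refine (congrArg (fun s => Ψ.mat x z₀ (z, s)) hs).trans ?_
    ext1 u
    simp [mat, inTriv, Ψ.eq_id x z hx, coords_frame r 𝓔 hz]
  have hev : ∀ᶠ b in 𝓝 (chartAt T o o), (z, (chartAt T o).symm b) ∈
      (trivializationAt (Fin r → ℂ) 𝓔 (z₀, o)).baseSet :=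
    ((chartAt T o).tendsto_symm (mem_chart_source T o)).eventually
      ((Continuous.prodMk_right z).continuousAt.eventually
        ((Trivialization.open_baseSet _).mem_nhds hz))
  have heq : (fun b => Ψ.transportLogDet g x z ((chartAt T o).symm b)) =ᶠ[𝓝 (chartAt T o o)]
      fun b => Real.log (Complex.normSq (LinearMap.det A)) +
        (g.logDet (z₀, o) (z, (chartAt T o).symm b) -
          Real.log (Complex.normSq (LinearMap.det (m b).toLinearMap))) := by
    filter_upwards [hev] with b hb
    set t := (chartAt T o).symm b
    let N : Module.End ℂ (Fin r → ℂ) :=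
      coords r 𝓔 (z₀, o) (z, t) ∘ₗ (Ψ.ψ x z t).symm.toLinearMap ∘ₗ frame r 𝓔 (z₀, o) (z, o)
    have hN : LinearMap.det N ≠ 0 := det_coords_comp_ne_zero hb hz (Ψ.ψ x z t).symm
    have hNM : LinearMap.det N * LinearMap.det (m b).toLinearMap = 1 := by
      rw [← LinearMap.det_comp]
      have : N ∘ₗ (m b).toLinearMap = LinearMap.id := by
        ext1 u
        ext1
        simp [N, m, t, mat, inTriv, frame_coords r 𝓔 hz, coords_frame r 𝓔 hb]
      rw [this, LinearMap.det_id]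
    have hfac : (Ψ.ψ x z t).symm.toLinearMap ∘ₗ frame r 𝓔 (z, o) (z, o) =
        (frame r 𝓔 (z₀, o) (z, t) ∘ₗ N) ∘ₗ A := by
      ext1 u
      ext1
      simp [N, A, frame_coords r 𝓔 hz, frame_coords r 𝓔 hb]
    have hM : LinearMap.det (m b).toLinearMap ≠ 0 := right_ne_zero_of_mul_eq_one hNM
    have hlog : Real.log (Complex.normSq (LinearMap.det N)) =
        - Real.log (Complex.normSq (LinearMap.det (m b).toLinearMap)) := by
      rw [eq_inv_of_mul_eq_one_left hNM, Complex.normSq_inv, Real.log_inv]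
    have hNA : LinearMap.det (N ∘ₗ A) ≠ 0 := by
      rw [LinearMap.det_comp]; exact mul_ne_zero hN hA
    rw [transportLogDet, hfac, LinearMap.comp_assoc, log_gramDet_comp (g.conj_symm _) (g.pos _)
      (frame_injective hb) hNA, LinearMap.det_comp, Complex.normSq_mul,
      Real.log_mul (by simpa using hN) (by simpa using hA), hlog, g.logDet_eq]
    ring
  have dm := differentiableAt_chart_self dx
  have ddet : HasFDerivAt (fun A : (Fin r → ℂ) →L[ℂ] (Fin r → ℂ) => LinearMap.det A.toLinearMap)
      (traceL r) (m (chartAt T o o)) := by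
    rw [hone]
    refine ((contDiff_det.differentiable one_ne_zero).differentiableAt.hasFDerivAt).congr_fderiv ?_
    ext1 B
    exact fderiv_det_one B
  have dd := ddet.comp (chartAt T o o) dm.hasFDerivAt
  have dlog := hasFDerivAt_log_normSq dd.differentiableAt (by
    simp only [Function.comp_apply]
    rw [hone]
    exact LinearMap.det_id)
  have htot := ((dg.hasFDerivAt.sub dlog).const_add
    (Real.log (Complex.normSq (LinearMap.det A)))).congr_of_eventuallyEq heq
  have hv : traceL r (dirDeriv v (fun t => Ψ.mat x z₀ (z, t))) =
      fderiv ℂ ((fun A : (Fin r → ℂ) →L[ℂ] (Fin r → ℂ) => LinearMap.det A.toLinearMap) ∘ m)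
        (chartAt T o o) v := by
    rw [dd.fderiv]
    exact congrArg (traceL r) (dirDeriv_eq_fderiv v dx)
  rw [transportDeriv, htot.fderiv, hv]
  rfl

theorem trace_hCochain (v : TangentSpace 𝓘(ℂ, T) o) {x y z z₀ : X} (hx : z ∈ Ψ.U x)
    (hy : z ∈ Ψ.U y) (hz : (z, o) ∈ (trivializationAt (Fin r → ℂ) 𝓔 (z₀, o)).baseSet)
    (dx : MDifferentiableAt 𝓘(ℂ, T) 𝓘(ℂ, (Fin r → ℂ) →L[ℂ] (Fin r → ℂ))
      (fun t : S => Ψ.mat x z₀ (z, t)) o)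
    (dy : MDifferentiableAt 𝓘(ℂ, T) 𝓘(ℂ, (Fin r → ℂ) →L[ℂ] (Fin r → ℂ))
      (fun t : S => Ψ.mat y z₀ (z, t)) o) :
    LinearMap.trace ℂ _ (Ψ.hCochain v x y z) =
      traceL r (dirDeriv v (fun t => Ψ.mat x z₀ (z, t))) -
        traceL r (dirDeriv v (fun t => Ψ.mat y z₀ (z, t))) := by
  rw [← map_sub, ← Ψ.hCochain_coords v hx hy hz dx dy]
  exact (LinearMap.trace_conj' (Ψ.hCochain v x y z) (coordsEquiv r 𝓔 hz)).symm

variable [IsManifold 𝓘(ℂ, E) ω X] [IsManifold 𝓘(ℂ, T) ω S]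

/-- This passes from a single tangent vector to the complex line it spans, which the definition of
`V` requires. -/
theorem hClass_smul (c : ℂ) (v : TangentSpace 𝓘(ℂ, T) o) :
    Ψ.hClass (c • v) = c • Ψ.hClass v := by
  have h : Ψ.hCochain (c • v) = c • Ψ.hCochain v := by
    funext x y z
    have e : ∀ f : S → (Fin r → ℂ) →L[ℂ] (Fin r → ℂ),
        dirDeriv (c • v) f = c • dirDeriv v f := fun f =>
      (mfderiv 𝓘(ℂ, T) 𝓘(ℂ, (Fin r → ℂ) →L[ℂ] (Fin r → ℂ)) f o : T →L[ℂ] _).map_smul c v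
    simp only [hCochain, Pi.smul_apply, e]
    exact map_smul (coordsEquiv r 𝓔 (mem_base r 𝓔 (z, o))).symm.conj c _
  exact congrArg (SectionSheaf.H1.mk _) (Subtype.ext h)

variable [ContMDiffVectorBundle ω (Fin r → ℂ) 𝓔 (𝓘(ℂ, E).prod 𝓘(ℂ, T))]

variable {g}

/-- The derivative of `log det g` in a common frame occurs in both transported derivatives and
cancels, leaving the real parts of the traces of `∂_v ψ_x` and `∂_v ψ_y`. -/
theorem re_trace_hCochain (hg : g.IsRicciFlat o) (v : TangentSpace 𝓘(ℂ, T) o) {x y z : X}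
    (hx : z ∈ Ψ.U x) (hy : z ∈ Ψ.U y) :
    (LinearMap.trace ℂ _ (Ψ.hCochain v x y z)).re =
      Ψ.transportDeriv g v y z / 2 - Ψ.transportDeriv g v x z / 2 := by
  have hz := mem_base r 𝓔 (z, o)
  have dx := (Ψ.mat_eventually_mdifferentiable hx).self_of_nhds
  have dy := (Ψ.mat_eventually_mdifferentiable hy).self_of_nhds
  obtain ⟨f, hf⟩ := hg.exists_holomorphic z v
  have dg := hf.self_of_nhds.2.1
  rw [Ψ.transportDeriv_eq g v hx hz dx dg, Ψ.transportDeriv_eq g v hy hz dy dg,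
    Ψ.trace_hCochain v hx hy hz dx dy, Complex.sub_re]
  ring

theorem exists_holomorphic_re_eq_transportDeriv (hg : g.IsRicciFlat o)
    (v : TangentSpace 𝓘(ℂ, T) o) (x : X) :
    ∃ q : X → ℂ, ∀ᶠ z in 𝓝 x, z ∈ Ψ.U x ∧ MDifferentiableAt 𝓘(ℂ, E) 𝓘(ℂ, ℂ) q z ∧
      (q z).re = Ψ.transportDeriv g v x z / 2 := by
  obtain ⟨f, hf⟩ := hg.exists_holomorphic x v
  have hxx : x ∈ Ψ.U x := (Ψ.U x).mem
  have hm : ∀ᶠ p in 𝓝 (x, o), ContMDiffAt (𝓘(ℂ, E).prod 𝓘(ℂ, T))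
      𝓘(ℂ, (Fin r → ℂ) →L[ℂ] (Fin r → ℂ)) ω (Ψ.mat x x) p :=
    (contMDiffAt_iff_contMDiffAt_nhds (by simp)).1 (Ψ.mat_contMDiffAt hxx)
  -- Half the formula of `transportDeriv_eq`, with `∂_v log det g` replaced by the holomorphic `f`
  -- whose real part it is. The frame stays fixed at `(x, o)` so that the trace term is holomorphic
  -- in `z`.
  refine ⟨fun z => (1 / 2 : ℂ) * f z - traceL r (dirDeriv v (fun t => Ψ.mat x x (z, t))), ?_⟩
  filter_upwards [hf, (Continuous.prodMk_left o).continuousAt.eventually hm,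
    (Ψ.U x).isOpen.mem_nhds hxx, Ψ.mat_eventually_mdifferentiable hxx,
    eventually_mem_base r 𝓔 x o] with z k₁ k₂ k₃ k₄ k₅
  refine ⟨k₃, ?_, ?_⟩
  · exact (k₁.1.const_smul (1 / 2 : ℂ)).sub
      ((traceL r).differentiableAt.mdifferentiableAt.comp z (mdifferentiableAt_dirDeriv v k₂))
  · rw [Ψ.transportDeriv_eq g v k₃ k₅ k₄ k₁.2.1, ← k₁.2.2, Complex.sub_re]
    simp
    ring

theorem smul_trace_hClass_mem_range (hg : g.IsRicciFlat o) (v : TangentSpace 𝓘(ℂ, T) o) :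
    (1 / (2 * (Real.pi : ℂ) * Complex.I)) • traceMap E r 𝓔 o (Ψ.hClass v) ∈
      Set.range (iStar E X) := by
  -- Each `q x` is defined only near `x`, so the cover is refined to neighbourhoods `W x` inside `U
  -- x`, keeping the same index set.
  choose q hq using Ψ.exists_holomorphic_re_eq_transportDeriv hg v
  choose W hW hWo hxW using fun x => eventually_nhds_iff.1 (hq x)
  refine smul_mk_mem_range_iStar _ (fun x => ⟨⟨W x, hWo x⟩, hxW x⟩) q
    (fun x z hz => (hW x z hz).2.1) fun x y z hx hy => ?_
  rw [Complex.sub_re, (hW x z hx).2.2, (hW y z hy).2.2]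
  exact Ψ.re_trace_hCochain hg v (hW x z hx).1 (hW y z hy).1

end LocalTrivializations

end Deformation

end RicciFlat

theorem mainTheorem12
    {E : Type*} [NormedAddCommGroup E] [NormedSpace ℂ E] [FiniteDimensional ℂ E]
    {T : Type*} [NormedAddCommGroup T] [NormedSpace ℂ T] [FiniteDimensional ℂ T]
    -- `X` is a compact complex manifold
    {X : Type*} [TopologicalSpace X] [ChartedSpace E X] [IsManifold 𝓘(ℂ, E) ω X]
    [CompactSpace X] [T2Space X]
    -- `(S, o)` is a pointed complex manifold, the base of the deformation
    {S : Type*} [TopologicalSpace S] [ChartedSpace T S] [IsManifold 𝓘(ℂ, T) ω S] (o : S)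
    -- `𝓔` is a holomorphic vector bundle of rank `r` on `X × S`
    {r : ℕ} (𝓔 : X × S → Type*) [∀ p, AddCommGroup (𝓔 p)] [∀ p, Module ℂ (𝓔 p)]
    [TopologicalSpace (TotalSpace (Fin r → ℂ) 𝓔)] [∀ p, TopologicalSpace (𝓔 p)]
    [FiberBundle (Fin r → ℂ) 𝓔] [VectorBundle ℂ (Fin r → ℂ) 𝓔]
    [ContMDiffVectorBundle ω (Fin r → ℂ) 𝓔 (𝓘(ℂ, E).prod 𝓘(ℂ, T))]
    -- `g` is a hermitian metric on `𝓔` which makes the deformation Ricci-flat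
    (g : RicciFlat.HermitianMetric E T r 𝓔) (hg : g.IsRicciFlat o)
    -- `h` is the infinitesimal class in the direction `v`, formed with local trivializations `Ψ`
    (Ψ : RicciFlat.LocalTrivializations E T r 𝓔 o) (v : TangentSpace 𝓘(ℂ, T) o) :
    (1 / (2 * (Real.pi : ℂ) * Complex.I)) • RicciFlat.traceMap E r 𝓔 o (Ψ.hClass v) ∈
      RicciFlat.maxComplexSubspace E X := by
  -- The witness is the complex line spanned by the class: its element with coefficient `c` is the
  -- class attached to `c • v`, hence again comes from `H¹(X, ℝ)`.
  refine le_sSup (a := ℂ ∙ ((1 / (2 * (Real.pi : ℂ) * Complex.I)) •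
    RicciFlat.traceMap E r 𝓔 o (Ψ.hClass v))) ?_ (Submodule.mem_span_singleton_self _)
  intro a ha
  obtain ⟨c, rfl⟩ := Submodule.mem_span_singleton.1 ha
  rw [smul_comm, ← map_smul, ← Ψ.hClass_smul]
  exact Ψ.smul_trace_hClass_mem_range hg (c • v)
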